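/- Let $\mathbb F_q$ be a finite field with $q$ elements. An $n\times n$ matrix $A$ over $\mathbb F_q$ is alternating if $v^{t}Av=0$ for all $v\in\mathbb F_q^n$; let $\Lambda(n,q)$ be the linear space of these matrices, and let $\mathcal A\le\Lambda(n,q)$ be a linear subspace. A subspace $U\le\mathbb F_q^n$ is an isotropic space of $\mathcal A$ if $u^{t}Au'=0$ for all $u,u'\in U$ and all $A\in\mathcal A$. The isotropic decomposition number $\chi(\mathcal A)$ is the least $c\in\mathbb N$ for which there is a direct sum decomposition $\mathbb F_q^n=U_1\oplus\dots\oplus U_c$ into nonzero isotropic spaces of $\mathcal A$. Theorem. The isotropic decomposition number of $\mathcal A\le\Lambda(n,q)$ can be computed in time $q^{\frac{5}{12}n^2+O(n)}$. That is, there are an absolute constant $C$ and a single algorithm which, for every finite field $\mathbb F_q$, every $n$ and every $\mathcal A\le\Lambda(n,q)$ given by $n$, $q$ and the entries of a linear basis $A_1,\dots,A_m$ of $\mathcal A$, halts with output $\chi(\mathcal A)$ and, if $n\ge 1$, does so in time at most $q^{\frac{5}{12}n^2+Cn}$. Here algorithms are random access machine programs, with registers and arrays of natural numbers, in which the elements of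 $\mathbb F_q$ are encoded (by an arbitrary bijection) as $0,\dots,q-1$ and the four field operations are elementary operations on these codes, besides the usual arithmetic on natural numbers; time is logarithmic cost, i.e. every elementary operation is charged one plus the bit length of the numbers involved. -/

import Mathlib

open scoped Matrix

/-! ## Alternating matrix spaces, isotropic spaces, the isotropic decomposition number -/

/-- The space `Λ(n, F)` of all `n × n` alternating matrices over `F`. -/
def alternatingMatrices (n : ℕ) (F : Type*) [Field F] :
    Submodule F (Matrix (Fin n) (Fin n) F) where
  carrier := {A | ∀ v : Fin n → F, v ⬝ᵥ (A *ᵥ v) = 0}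
  zero_mem' := by
    intro v
    simp
  add_mem' := by
    intro A B hA hB v
    have h1 := hA v
    have h2 := hB v
    simp [Matrix.add_mulVec, h1, h2]
  smul_mem' := by
    intro c A hA v
    have h1 := hA v
    simp [Matrix.smul_mulVec, h1]

/-- `U ≤ F ^ n` is an isotropic space of the matrix space `𝒜`. -/
def IsIsotropicSpace {n : ℕ} {F : Type*} [Field F]
    (𝒜 : Submodule F (Matrix (Fin n) (Fin n) F)) (U : Submodule F (Fin n → F)) : Prop :=
  ∀ u ∈ U, ∀ u' ∈ U, ∀ A ∈ 𝒜, u ⬝ᵥ (A *ᵥ u') = 0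

/-- `U₁ ⊕ ⋯ ⊕ U_c` is an isotropic `c`-decomposition of `𝒜`: a direct sum decomposition of `F ^ n`
into `c` nonzero isotropic spaces. -/
def IsIsotropicDecomposition {n : ℕ} {F : Type*} [Field F]
    (𝒜 : Submodule F (Matrix (Fin n) (Fin n) F)) {c : ℕ}
    (U : Fin c → Submodule F (Fin n → F)) : Prop :=
  (∀ i, U i ≠ ⊥) ∧ (∀ i, IsIsotropicSpace 𝒜 (U i)) ∧ DirectSum.IsInternal U

/-- The isotropic decomposition number `χ(𝒜)`: the least `c` such that `𝒜` has an isotropic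
`c`-decomposition. -/
noncomputable def isotropicDecompositionNumber {n : ℕ} {F : Type*} [Field F]
    (𝒜 : Submodule F (Matrix (Fin n) (Fin n) F)) : ℕ :=
  sInf {c : ℕ | ∃ U : Fin c → Submodule F (Fin n → F), IsIsotropicDecomposition 𝒜 U}

/-! ## The machine model: random access programs with finite-field arithmetic

A program works on finitely many registers and finitely many arrays (those that occur in its text),
all of whose cells hold natural numbers.  The elements of the finite field `F` with `q` elements are
stored as the numbers `0, …, q - 1`.  Besides the usual arithmetic on natural numbers, the four
field operations are elementary operations.  Time is logarithmic cost: every elementary operation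
is charged the bit length of all numbers involved (operands, addresses and result), so that
large numbers do not come for free. -/

namespace FieldRAM

/-- Binary operations: those on natural numbers (truncated subtraction, integer division,
remainder) and those of the field. -/
inductive Op : Type
  | add | sub | mul | div | mod
  | fadd | fsub | fmul | fdiv

/-- Expressions. -/
inductive Expr : Type
  /-- a constant -/
  | lit (c : ℕ)
  /-- the content of register `x` -/
  | reg (x : ℕ)
  /-- the content of cell number `i` of array `a` -/
  | get (a : ℕ) (i : Expr)
  /-- a binary operation -/
  | bin (o : Op) (e₁ e₂ : Expr)

/-- Programs. -/
inductive Prog : Type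
  /-- register `x` := value of `e` -/
  | assign (x : ℕ) (e : Expr)
  /-- cell number `i` of array `a` := value of `e` -/
  | put (a : ℕ) (i e : Expr)
  /-- first `P`, then `Q` -/
  | seq (P Q : Prog)
  /-- if `e ≠ 0` then `P` else `Q` -/
  | ite (e : Expr) (P Q : Prog)
  /-- while `e ≠ 0` do `P` -/
  | loop (e : Expr) (P : Prog)

/-- A memory configuration: contents of the registers and of the arrays. -/
structure State : Type where
  reg : ℕ → ℕ
  arr : ℕ → ℕ → ℕ

/-- Overwrite a register. -/
def State.setReg (s : State) (x v : ℕ) : State :=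
  { s with reg := Function.update s.reg x v }

/-- Overwrite a cell of an array. -/
def State.setArr (s : State) (a i v : ℕ) : State :=
  { s with arr := Function.update s.arr a (Function.update (s.arr a) i v) }

section Semantics

variable {F : Type*} [Field F] [Fintype F]

/-- The field element with a given code (numbers that are not codes are read as `0`). -/
def decode (enc : F ≃ Fin (Fintype.card F)) (c : ℕ) : F :=
  if h : c < Fintype.card F then enc.symm ⟨c, h⟩ else 0

/-- The result of an operation. -/
def Op.eval (enc : F ≃ Fin (Fintype.card F)) : Op → ℕ → ℕ → ℕ
  | .add, x, y => x + y
  | .sub, x, y => x - y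
  | .mul, x, y => x * y
  | .div, x, y => x / y
  | .mod, x, y => x % y
  | .fadd, x, y => (enc (decode enc x + decode enc y) : ℕ)
  | .fsub, x, y => (enc (decode enc x - decode enc y) : ℕ)
  | .fmul, x, y => (enc (decode enc x * decode enc y) : ℕ)
  | .fdiv, x, y => (enc (decode enc x / decode enc y) : ℕ)

/-- The value of an expression. -/
def Expr.eval (enc : F ≃ Fin (Fintype.card F)) (s : State) : Expr → ℕ
  | .lit c => c
  | .reg x => s.reg x
  | .get a i => s.arr a (i.eval enc s)
  | .bin o e₁ e₂ => o.eval enc (e₁.eval enc s) (e₂.eval enc s)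

/-- The cost of evaluating an expression: one plus the bit length of the value, for the expression
and for every one of its subexpressions. -/
def Expr.cost (enc : F ≃ Fin (Fintype.card F)) (s : State) : Expr → ℕ
  | .lit c => 1 + Nat.size c
  | .reg x => 1 + Nat.size (s.reg x)
  | .get a i => i.cost enc s + (1 + Nat.size (s.arr a (i.eval enc s)))
  | .bin o e₁ e₂ => e₁.cost enc s + e₂.cost enc s +
      (1 + Nat.size (o.eval enc (e₁.eval enc s) (e₂.eval enc s)))

/-- `Exec enc P s s' t`: the program `P`, started in configuration `s`, halts in
configuration `s'` after time `t`. -/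
inductive Exec (enc : F ≃ Fin (Fintype.card F)) : Prog → State → State → ℕ → Prop
  | assign (x : ℕ) (e : Expr) (s : State) :
      Exec enc (.assign x e) s (s.setReg x (e.eval enc s)) (e.cost enc s + 1)
  | put (a : ℕ) (i e : Expr) (s : State) :
      Exec enc (.put a i e) s (s.setArr a (i.eval enc s) (e.eval enc s))
        (i.cost enc s + e.cost enc s + 1)
  | seq {P Q : Prog} {s s' s'' : State} {t t' : ℕ}
      (hP : Exec enc P s s' t) (hQ : Exec enc Q s' s'' t') :
      Exec enc (.seq P Q) s s'' (t + t')
  | ite_true {e : Expr} {P Q : Prog} {s s' : State} {t : ℕ} (he : e.eval enc s ≠ 0)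
      (hP : Exec enc P s s' t) :
      Exec enc (.ite e P Q) s s' (e.cost enc s + 1 + t)
  | ite_false {e : Expr} {P Q : Prog} {s s' : State} {t : ℕ} (he : e.eval enc s = 0)
      (hQ : Exec enc Q s s' t) :
      Exec enc (.ite e P Q) s s' (e.cost enc s + 1 + t)
  | loop_true {e : Expr} {P : Prog} {s s' s'' : State} {t t' : ℕ} (he : e.eval enc s ≠ 0)
      (hP : Exec enc P s s' t) (hL : Exec enc (.loop e P) s' s'' t') :
      Exec enc (.loop e P) s s'' (e.cost enc s + 1 + t + t')
  | loop_false {e : Expr} {P : Prog} {s : State} (he : e.eval enc s = 0) :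
      Exec enc (.loop e P) s s (e.cost enc s + 1)

/-- The start configuration for the input `A₁, …, A_m ∈ M(n, F)`: registers `0, 1, 2` hold `n`,
`q = |F|` and `m`; cell number `(k * n + i) * n + j` of array `0` holds the code of the entry
`(i, j)` of the `k`-th matrix (all indices counted from `0`); everything else is `0`. -/
def inputState (enc : F ≃ Fin (Fintype.card F)) {n m : ℕ}
    (A : Fin m → Matrix (Fin n) (Fin n) F) : State where
  reg := fun x => if x = 0 then n else if x = 1 then Fintype.card F else if x = 2 then m else 0
  arr := fun a p =>
    if a = 0 then
      if h : p < m * (n * n) then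
        let z : Fin (m * (n * n)) := ⟨p, h⟩
        (enc (A z.divNat z.modNat.divNat z.modNat.modNat) : ℕ)
      else 0
    else 0

end Semantics

end FieldRAM

/-!
The program decides, for every `c < n`, whether `c` isotropic spaces of `𝒜` can span `F ^ n`. Since
a sum of isotropic spaces refines to a direct sum of at most as many nonzero ones, and the `n`
coordinate lines are isotropic, `χ(𝒜)` is the number of `c < n` for which the answer is no
(`isotropicDecompositionNumber_eq_sum`).

The question is settled by inclusion-exclusion over the lattice of subspaces. If `a(W)` is the
number of isotropic spaces inside `W`, then `∑_W μ(W) a(W) ^ c`, with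
`μ(W) = (-1) ^ j * q ^ (j choose 2)` for `W` of codimension `j`, is the number of `c`-tuples of
isotropic spaces that span `F ^ n` (`sum_moebiusWeight_mul_numIsotropic`). A subspace is represented
by the square form `E` of its reduced echelon basis, an idempotent upper triangular matrix, and
`X ≤ W` means that `x E = x` for all `x ∈ X`. Uniqueness of the reduced echelon form is not needed:
the isotropic spaces are counted through their echelon matrices `G`, and those inside `W` are
exactly the products `K E` with `K` an echelon matrix supported on the pivots of `E`
(`numIsotropic_eq`).

The identity `∑_{W ≥ X} μ(W) = [X = F ^ n]` (`sum_moebiusWeight`) is reduced to a product. The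
factor `q ^ (j choose 2)` counts the ways to let the `j` non-pivot coordinates depend on all earlier
coordinates instead of the earlier pivot coordinates only (`card_relations_eq`). After this change
the dependences of different coordinates are independent of each other, so that the sum is
`∏_j (1 - f j)`, where `f j` is the number of ways to express the `j`-th coordinate on `X` by the
earlier ones. All `f j` vanish if `X` is everything; otherwise the first dependent coordinate has
`f j = 1`.

There are at most `2 ^ n * q ^ (d * (n - d))` echelon matrices `E` of rank `d`, and for each of them
at most `2 ^ n * q ^ (d ^ 2 / 4)` coefficient matrices `K`. As `d (n - d) + d ^ 2 / 4 ≤ n ^ 2 / 3`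
(`mul_sub_add_le`), the enumeration takes `q ^ (n ^ 2 / 3 + O(n))` rounds, which is even less than
required, and each round costs `q ^ O(n)`.

The program is composed from code fragments by a few combinators; the predicate `FieldRAM.Comp`
records the value of a fragment and its cost in the form `W * Q ^ k`, where `Q = q ^ (n + 1)` and
the weight `W` accounts for the long loops. Matrices and subsets are enumerated as the digits of a
loop counter.
-/

/-! ### Machine programs composed from code fragments -/

namespace FieldRAM

section Logic

variable {F : Type*} [Fintype F]

/-- A code fragment, given by the depth `d` at which it runs: `b d` is a program that leaves its
result in register `d` and does not touch the registers below `d`. -/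
abbrev Code : Type := ℕ → Prog

/-- What is fixed during a run: the coding of the field, the dimension, and the input array. -/
structure Setting (F : Type*) [Fintype F] where
  enc : F ≃ Fin (Fintype.card F)
  n : ℕ
  inp : ℕ → ℕ

/-- The unit in which costs are measured; the powers of `q ^ (n + 1)` are the negligible factors. -/
def Setting.Q (I : Setting F) : ℕ := Fintype.card F ^ (I.n + 1)

theorem Setting.card_le_Q (I : Setting F) : Fintype.card F ≤ I.Q :=
  Nat.le_self_pow (by omega) _

theorem Setting.Q_pow (I : Setting F) (k : ℕ) :
    I.Q ^ k = Fintype.card F ^ ((I.n + 1) * k) :=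
  (pow_mul _ _ _).symm

/-- A context: the registers below `depth` hold the values given by `reg`. -/
structure Ctx : Type where
  depth : ℕ
  reg : ℕ → ℕ

/-- `Γ ≤ Γ'` if `Γ'` knows at least the registers of `Γ`, with the same contents. -/
instance : LE Ctx := ⟨fun Γ Γ' => Γ.depth ≤ Γ'.depth ∧ ∀ x < Γ.depth, Γ'.reg x = Γ.reg x⟩

theorem Ctx.le_refl (Γ : Ctx) : Γ ≤ Γ := ⟨le_rfl, fun _ _ => rfl⟩

theorem Ctx.le_trans {Γ Γ' Γ'' : Ctx} (h : Γ ≤ Γ') (h' : Γ' ≤ Γ'') : Γ ≤ Γ'' :=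
  ⟨h.1.trans h'.1, fun x hx => (h'.2 x (hx.trans_le h.1)).trans (h.2 x hx)⟩

theorem Ctx.le_lower {d d' : ℕ} {r r' : ℕ → ℕ} (hd : d ≤ d')
    (h : (⟨d', r⟩ : Ctx) ≤ ⟨d', r'⟩) : (⟨d, r⟩ : Ctx) ≤ ⟨d, r'⟩ :=
  ⟨le_rfl, fun x hx => h.2 x (lt_of_lt_of_le hx hd)⟩

variable [Field F]

/-- The code `b` computes `v` in every context extending `Γ`, in time at most `W * Q ^ k`; moreover
the value `v` has at most `Q ^ k` bits. The weight `W` carries the number of rounds of the long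
loops, everything else is absorbed into the power of `Q`. In the rules below, the increments of `k`
are generous: it only matters that they do not depend on the input. -/
def Comp (I : Setting F) (Γ : Ctx) (b : Code) (v W k : ℕ) : Prop :=
  1 ≤ W ∧ Nat.size v ≤ I.Q ^ k ∧
    ∀ (d : ℕ) (s : State), Γ ≤ ⟨d, s.reg⟩ → s.arr 0 = I.inp →
      ∃ s' t, Exec I.enc (b d) s s' t ∧ t ≤ W * I.Q ^ k ∧ s'.reg d = v ∧
        (⟨d, s.reg⟩ : Ctx) ≤ ⟨d, s'.reg⟩ ∧ s'.arr 0 = I.inp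

variable {I : Setting F} {Γ Γ' : Ctx}

theorem Setting.two_le_Q (I : Setting F) : 2 ≤ I.Q :=
  (Fintype.one_lt_card (α := F)).trans_le I.card_le_Q

theorem Setting.Q_pos (I : Setting F) (k : ℕ) : 1 ≤ I.Q ^ k :=
  Nat.one_le_pow _ _ (by have := I.two_le_Q; omega)

theorem Setting.Q_mono (I : Setting F) {k l : ℕ} (h : k ≤ l) : I.Q ^ k ≤ I.Q ^ l :=
  Nat.pow_le_pow_right (by have := I.two_le_Q; omega) h

/-- A numerical factor costs a bounded power of `Q`. -/
theorem Setting.mul_Q_le (I : Setting F) {c j : ℕ} (hc : c ≤ 2 ^ j) (k : ℕ) :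
    c * I.Q ^ k ≤ I.Q ^ (k + j) := by
  rw [pow_add, mul_comm]
  exact Nat.mul_le_mul_left _ (hc.trans (Nat.pow_le_pow_left I.two_le_Q j))

theorem Setting.n_lt_Q (I : Setting F) : I.n < I.Q := by
  have h1 : I.n + 1 < 2 ^ (I.n + 1) := Nat.lt_two_pow_self
  have h2 : 2 ^ (I.n + 1) ≤ Fintype.card F ^ (I.n + 1) :=
    Nat.pow_le_pow_left (Fintype.one_lt_card (α := F)) _
  unfold Setting.Q
  omega

theorem size_le_self (v : ℕ) : Nat.size v ≤ v :=
  Nat.size_le.2 Nat.lt_two_pow_self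

theorem Comp.weaken {b : Code} {v W k : ℕ} (h : Comp I Γ b v W k) (hΓ : Γ ≤ Γ') :
    Comp I Γ' b v W k :=
  ⟨h.1, h.2.1, fun d s hs => h.2.2 d s (Ctx.le_trans hΓ hs)⟩

theorem Comp.mono {b : Code} {v W k W' k' : ℕ} (h : Comp I Γ b v W k) (hW : W ≤ W')
    (hk : k ≤ k') : Comp I Γ b v W' k' := by
  refine ⟨h.1.trans hW, h.2.1.trans (I.Q_mono hk), fun d s hs ha => ?_⟩
  obtain ⟨s', t, h1, h2, h3⟩ := h.2.2 d s hs ha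
  exact ⟨s', t, h1, h2.trans (Nat.mul_le_mul hW (I.Q_mono hk)), h3⟩

theorem Comp.size_le {b : Code} {v W k : ℕ} (h : Comp I Γ b v W k) : Nat.size v ≤ I.Q ^ k :=
  h.2.1

theorem le_setReg (s : State) (d x v : ℕ) (hx : d ≤ x) :
    (⟨d, s.reg⟩ : Ctx) ≤ ⟨d, (s.setReg x v).reg⟩ :=
  ⟨le_rfl, fun y hy => Function.update_of_ne (show y ≠ x from (hy.trans_le hx).ne) _ _⟩

def litC (c : ℕ) : Code := fun d => .assign d (.lit c)

def varC (x : ℕ) : Code := fun d => .assign d (.reg x)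

def opC (o : Op) (a b : Code) : Code := fun d =>
  .seq (a d) (.seq (b (d + 1)) (.assign d (.bin o (.reg d) (.reg (d + 1)))))

/-- Read the cell of the input array whose number is computed by `a`. -/
def inpC (a : Code) : Code := fun d => .seq (a d) (.assign d (.get 0 (.reg d)))

def iteC (c a b : Code) : Code := fun d => .seq (c d) (.ite (.reg d) (a d) (b d))

/-- Bounded iteration: starting from `init`, apply `body i` for `i = 0, 1, …` below the value of
`N`. The body receives codes that read the counter and the accumulated value. -/
def iterC (N init : Code) (body : Code → Code → Code) : Code := fun d =>
  .seq (N d) <| .seq (init (d + 2)) <| .seq (.assign (d + 1) (.lit 0)) <|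
    .seq (.loop (.bin .sub (.reg d) (.reg (d + 1)))
      (.seq (body (varC (d + 1)) (varC (d + 2)) (d + 3))
        (.seq (.assign (d + 2) (.reg (d + 3)))
          (.assign (d + 1) (.bin .add (.reg (d + 1)) (.lit 1))))))
      (.assign d (.reg (d + 2)))

theorem comp_var (x k : ℕ) (hx : x < Γ.depth) (hk : Nat.size (Γ.reg x) ≤ I.Q ^ k) :
    Comp I Γ (varC x) (Γ.reg x) 1 (k + 2) := by
  refine ⟨le_rfl, hk.trans (I.Q_mono (by omega)), fun d s hs ha => ?_⟩
  have h1 : s.reg x = Γ.reg x := hs.2 x hx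
  refine ⟨_, _, .assign d (.reg x) s, ?_, ?_, le_setReg s d d _ le_rfl, ha⟩
  · have h2 := I.mul_Q_le (c := 3) (j := 2) (by norm_num) k
    have h3 := I.Q_pos k
    simp only [Expr.cost, h1]
    omega
  · simp [State.setReg, Expr.eval, h1]

theorem comp_lit (c : ℕ) : Comp I Γ (litC c) c 1 (c + 2) := by
  have h0 : c + 2 ≤ I.Q ^ (c + 2) :=
    (Nat.lt_two_pow_self (n := c + 2)).le.trans (Nat.pow_le_pow_left I.two_le_Q _)
  have h1 := size_le_self c
  refine ⟨le_rfl, by omega, fun d s hs ha => ?_⟩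
  refine ⟨_, _, .assign d (.lit c) s, ?_, ?_, le_setReg s d d _ le_rfl, ha⟩
  · simp only [Expr.cost]
    omega
  · simp [State.setReg, Expr.eval]

theorem size_add_le (x y : ℕ) : Nat.size (x + y) ≤ Nat.size x + Nat.size y + 1 := by
  have h1 := Nat.lt_size_self x
  have h2 := Nat.lt_size_self y
  rw [Nat.size_le, pow_succ, pow_add]
  have h3 : 1 ≤ 2 ^ Nat.size x := Nat.one_le_two_pow
  have h4 : 1 ≤ 2 ^ Nat.size y := Nat.one_le_two_pow
  nlinarith

theorem size_mul_le (x y : ℕ) : Nat.size (x * y) ≤ Nat.size x + Nat.size y := by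
  rw [Nat.size_le, pow_add]
  exact Nat.mul_lt_mul'' (Nat.lt_size_self x) (Nat.lt_size_self y)

theorem size_op_le (enc : F ≃ Fin (Fintype.card F)) (o : Op) (x y : ℕ) :
    Nat.size (o.eval enc x y) ≤ Nat.size x + Nat.size y + 1 + Fintype.card F := by
  have hF (a : F) : Nat.size (enc a : ℕ) ≤ Fintype.card F :=
    (size_le_self _).trans (enc a).2.le
  have hx (z : ℕ) (hz : z ≤ x) : Nat.size z ≤ Nat.size x := Nat.size_le_size hz
  cases o <;> simp only [Op.eval]
  · have := size_add_le x y; omega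
  · have := hx _ (Nat.sub_le x y); omega
  · have := size_mul_le x y; omega
  · have := hx _ (Nat.div_le_self x y); omega
  · have := hx _ (Nat.mod_le x y); omega
  all_goals exact (hF _).trans (by omega)

theorem comp_op (o : Op) {a b : Code} {x y W k l : ℕ} (ha : Comp I Γ a x W k)
    (hb : Comp I Γ b y W l) : Comp I Γ (opC o a b) (o.eval I.enc x y) W (max k l + 5) := by
  replace ha := ha.mono le_rfl (le_max_left k l)
  replace hb := hb.mono le_rfl (le_max_right k l)
  generalize max k l = k at ha hb
  have hW := ha.1
  have h1 := size_op_le I.enc o x y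
  have h2 := ha.2.1
  have h3 := hb.2.1
  have h4 := I.card_le_Q
  have h6 : I.Q ≤ I.Q ^ (k + 1) := Nat.le_self_pow (by omega) _
  have h8 : I.Q ^ (k + 1) ≤ W * I.Q ^ (k + 1) := Nat.le_mul_of_pos_left _ hW
  have h9 := I.mul_Q_le (c := 16) (j := 4) (by norm_num) (k + 1)
  have h9' := Nat.mul_le_mul_left W h9
  have h10 := I.mul_Q_le (c := 2) (j := 1) (by norm_num) k
  have h11 := I.Q_pos k
  refine ⟨hW, by grind, fun d s hs hi => ?_⟩
  obtain ⟨s1, t1, e1, l1, v1, c1, i1⟩ := ha.2.2 d s hs hi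
  have hs1 : (⟨d, s1.reg⟩ : Ctx) ≤ ⟨d + 1, s1.reg⟩ := ⟨by simp, fun _ _ => rfl⟩
  obtain ⟨s2, t2, e2, l2, v2, c2, i2⟩ :=
    hb.2.2 (d + 1) s1 (Ctx.le_trans hs (Ctx.le_trans c1 hs1)) i1
  have v1' : s2.reg d = x := (c2.2 d (by simp)).trans v1
  refine ⟨_, _, .seq e1 (.seq e2 (.assign d _ s2)), ?_, ?_, ?_, i2⟩
  · simp only [Expr.cost, Expr.eval, v1', v2]
    have e1 : W * I.Q ^ (k + 1 + 4) = W * I.Q ^ (k + 5) := rfl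
    have h10' := Nat.mul_le_mul_left W h10
    have e2 : W * (2 * I.Q ^ k) = 2 * (W * I.Q ^ k) := by ring
    have e3 : W * (16 * I.Q ^ (k + 1)) = 16 * (W * I.Q ^ (k + 1)) := by ring
    omega
  · simp [State.setReg, Expr.eval, v1', v2]
  · exact Ctx.le_trans c1 (Ctx.le_trans (Ctx.le_lower (by omega) c2)
      (le_setReg s2 d d _ le_rfl))

theorem comp_inp {a : Code} {x W k l : ℕ} (ha : Comp I Γ a x W k)
    (hl : Nat.size (I.inp x) ≤ I.Q ^ l) : Comp I Γ (inpC a) (I.inp x) W (max k l + 3) := by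
  replace ha := ha.mono le_rfl (le_max_left k l)
  replace hl := hl.trans (I.Q_mono (le_max_right k l))
  generalize max k l = k at ha hl
  have hW := ha.1
  have h2 := ha.2.1
  have h7 : I.Q ^ k ≤ W * I.Q ^ k := Nat.le_mul_of_pos_left _ hW
  have h5 := Nat.mul_le_mul_left W (I.mul_Q_le (c := 8) (j := 3) (by norm_num) k)
  have h11 := I.Q_pos k
  refine ⟨hW, hl.trans (I.Q_mono (by omega)), fun d s hs hi => ?_⟩
  obtain ⟨s1, t1, e1, l1, v1, c1, i1⟩ := ha.2.2 d s hs hi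
  refine ⟨_, _, .seq e1 (.assign d _ s1), ?_, ?_, ?_, i1⟩
  · simp only [Expr.cost, Expr.eval, v1, i1]
    have e2 : W * (8 * I.Q ^ k) = 8 * (W * I.Q ^ k) := by ring
    omega
  · simp [State.setReg, Expr.eval, v1, i1]
  · exact Ctx.le_trans c1 (le_setReg s1 d d _ le_rfl)

theorem comp_ite {c a b : Code} {x v W k l : ℕ} (hc : Comp I Γ c x W k)
    (ha : x ≠ 0 → Comp I Γ a v W l) (hb : x = 0 → Comp I Γ b v W l) :
    Comp I Γ (iteC c a b) v W (max k l + 3) := by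
  replace hc := hc.mono le_rfl (le_max_left k l)
  replace ha := fun h => (ha h).mono le_rfl (le_max_right k l)
  replace hb := fun h => (hb h).mono le_rfl (le_max_right k l)
  generalize max k l = k at ha hb hc
  have hW := hc.1
  have h2 := hc.2.1
  have h7 : I.Q ^ k ≤ W * I.Q ^ k := Nat.le_mul_of_pos_left _ hW
  have h5 := Nat.mul_le_mul_left W (I.mul_Q_le (c := 8) (j := 3) (by norm_num) k)
  have e2 : W * (8 * I.Q ^ k) = 8 * (W * I.Q ^ k) := by ring
  have h11 := I.Q_pos k
  have key : ∀ p : Code, Comp I Γ p v W k → ∀ (d : ℕ) (s : State), Γ ≤ ⟨d, s.reg⟩ →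
      s.arr 0 = I.inp → (∀ s s' t, s.reg d = x → Exec I.enc (p d) s s' t →
        Exec I.enc (.ite (.reg d) (a d) (b d)) s s' ((Expr.reg d).cost I.enc s + 1 + t)) →
      ∃ s' t, Exec I.enc (iteC c a b d) s s' t ∧ t ≤ W * I.Q ^ (k + 3) ∧ s'.reg d = v ∧
        (⟨d, s.reg⟩ : Ctx) ≤ ⟨d, s'.reg⟩ ∧ s'.arr 0 = I.inp := by
    intro p hp d s hs hi hx
    obtain ⟨s1, t1, e1, l1, v1, c1, i1⟩ := hc.2.2 d s hs hi
    obtain ⟨s2, t2, e2, l2, v2, c2, i2⟩ := hp.2.2 d s1 (Ctx.le_trans hs c1) i1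
    refine ⟨_, _, .seq e1 (hx _ _ _ v1 e2), ?_, v2, Ctx.le_trans c1 c2, i2⟩
    simp only [Expr.cost, v1]
    omega
  by_cases hx : x = 0
  · have hb := hb hx
    refine ⟨hW, hb.2.1.trans (I.Q_mono (by omega)), fun d s hs hi => key b hb d s hs hi ?_⟩
    intro s s' t h e
    exact .ite_false (by simp [Expr.eval, h, hx]) e
  · have ha := ha hx
    refine ⟨hW, ha.2.1.trans (I.Q_mono (by omega)), fun d s hs hi => key a ha d s hs hi ?_⟩
    intro s s' t h e
    exact .ite_true (by simp [Expr.eval, h, hx]) e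

/-- The loop rule. The body is analysed for arbitrary codes `bi`, `ba` that yield the counter and
the accumulated value, so that the layout of the registers never shows up again. -/
theorem comp_iter {N init : Code} {body : Code → Code → Code} {Nv W kN k0 kf kb a : ℕ}
    (f w : ℕ → ℕ) (hN : Comp I Γ N Nv W kN) (h0 : Comp I Γ init (f 0) W k0)
    (hf : ∀ i ≤ Nv, Nat.size (f i) ≤ I.Q ^ kf)
    (hbody : ∀ i < Nv, ∀ Γ' : Ctx, Γ ≤ Γ' → ∀ bi ba : Code, Comp I Γ' bi i 1 (kN + 2) →
      Comp I Γ' ba (f i) 1 (kf + 2) → Comp I Γ' (body bi ba) (f (i + 1)) (w i) kb)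
    (hw : ∑ i ∈ Finset.range Nv, w i ≤ W * I.Q ^ a) :
    Comp I Γ (iterC N init body) (f Nv) W (max (max kN k0) (max kf kb) + a + 5) := by
  set K := max (max kN k0) (max kf kb) with hK
  have kN' : kN ≤ K := by omega
  have k0' : k0 ≤ K := by omega
  have kf' : kf ≤ K := by omega
  have kb' : kb ≤ K := by omega
  clear_value K
  clear hK
  have hW := hN.1
  set X := I.Q ^ K with hX
  have hX1 : 1 ≤ X := I.Q_pos K
  have sN : Nat.size Nv ≤ X := hN.2.1.trans (I.Q_mono kN')
  have si : ∀ i ≤ Nv, Nat.size i ≤ I.Q ^ kN := fun i hi =>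
    (Nat.size_le_size hi).trans hN.2.1
  have si' : ∀ i ≤ Nv, Nat.size i ≤ X := fun i hi => (Nat.size_le_size hi).trans sN
  have sf : ∀ i ≤ Nv, Nat.size (f i) ≤ X := fun i hi => (hf i hi).trans (I.Q_mono kf')
  refine ⟨hW, (sf Nv le_rfl).trans (I.Q_mono (by omega)), fun d s hs hi => ?_⟩
  obtain ⟨s1, t1, e1, l1, v1, c1, i1⟩ := hN.2.2 d s hs hi
  have up : ∀ (r : ℕ → ℕ) (j : ℕ), (⟨d, r⟩ : Ctx) ≤ ⟨d + j, r⟩ := fun r j =>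
    ⟨by simp, fun _ _ => rfl⟩
  obtain ⟨s2, t2, e2, l2, v2, c2, i2⟩ :=
    h0.2.2 (d + 2) s1 (Ctx.le_trans hs (Ctx.le_trans c1 (up _ _))) i1
  set s3 := s2.setReg (d + 1) 0 with hs3
  have e3 : Exec I.enc (.assign (d + 1) (.lit 0)) s2 s3 2 := .assign (d + 1) (.lit 0) s2
  have loop : ∀ (j i : ℕ) (r : State), i + j = Nv → (⟨d, s.reg⟩ : Ctx) ≤ ⟨d, r.reg⟩ →
      r.reg d = Nv → r.reg (d + 1) = i → r.reg (d + 2) = f i → r.arr 0 = I.inp →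
      ∃ r' t, Exec I.enc (.loop (.bin .sub (.reg d) (.reg (d + 1)))
        (.seq (body (varC (d + 1)) (varC (d + 2)) (d + 3))
          (.seq (.assign (d + 2) (.reg (d + 3)))
            (.assign (d + 1) (.bin .add (.reg (d + 1)) (.lit 1)))))) r r' t ∧
        t ≤ (∑ l ∈ Finset.Ico i Nv, w l) * (18 * X) + (3 * X + 4) ∧ r'.reg (d + 2) = f Nv ∧
        (⟨d, s.reg⟩ : Ctx) ≤ ⟨d, r'.reg⟩ ∧ r'.arr 0 = I.inp := by
    intro j
    induction j with
    | zero =>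
      intro i r hij hc rd r1 r2 ra
      obtain rfl : i = Nv := by omega
      refine ⟨r, _, .loop_false (by simp [Expr.eval, Op.eval, rd, r1]), ?_, r2, hc, ra⟩
      simp only [Expr.cost, Expr.eval, Op.eval, rd, r1, Nat.sub_self, Nat.size_zero]
      omega
    | succ j ih =>
      intro i r hij hc rd r1 r2 ra
      have hiN : i < Nv := by omega
      have hΓ : Γ ≤ ⟨d + 3, r.reg⟩ := Ctx.le_trans hs (Ctx.le_trans hc (up _ _))
      have hb := hbody i hiN ⟨d + 3, r.reg⟩ hΓ (varC (d + 1)) (varC (d + 2))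
        (by
          have := comp_var (I := I) (Γ := ⟨d + 3, r.reg⟩) (d + 1) kN (by simp)
            (by simpa [r1] using si i hiN.le)
          simpa [r1] using this)
        (by
          have := comp_var (I := I) (Γ := ⟨d + 3, r.reg⟩) (d + 2) kf (by simp)
            (by simpa [r2] using hf i hiN.le)
          simpa [r2] using this)
      obtain ⟨p, tp, ep, lp, vp, cp, ip⟩ := hb.2.2 (d + 3) r (Ctx.le_refl _) ra
      have pd : p.reg d = Nv := (cp.2 d (by simp)).trans rd
      have p1 : p.reg (d + 1) = i := (cp.2 (d + 1) (by simp)).trans r1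
      set p' := p.setReg (d + 2) (p.reg (d + 3)) with hp'
      have p'1 : p'.reg (d + 1) = i := by simp [hp', State.setReg, p1]
      set p'' := p'.setReg (d + 1) (i + 1) with hp''
      have ep' : Exec I.enc (.assign (d + 2) (.reg (d + 3))) p p'
        (1 + Nat.size (p.reg (d + 3)) + 1) := .assign _ (.reg (d + 3)) p
      have ep'' : Exec I.enc (.assign (d + 1) (.bin .add (.reg (d + 1)) (.lit 1))) p' p''
          ((1 + Nat.size i) + (1 + Nat.size 1) + (1 + Nat.size (i + 1)) + 1) := by
        have := Exec.assign (enc := I.enc) (d + 1) (.bin .add (.reg (d + 1)) (.lit 1)) p'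
        simpa only [Expr.cost, Expr.eval, Op.eval, p'1] using this
      have hcp : (⟨d, s.reg⟩ : Ctx) ≤ ⟨d, p''.reg⟩ :=
        Ctx.le_trans hc <| Ctx.le_trans (Ctx.le_lower (by omega) cp) <|
          Ctx.le_trans (le_setReg p d (d + 2) _ (by omega)) (le_setReg p' d (d + 1) _ (by omega))
      obtain ⟨r', t, er, lr, vr, cr, ir⟩ := ih (i + 1) p'' (by omega) hcp
        (by simp [hp', hp'', State.setReg, pd])
        (by simp [hp'', State.setReg])
        (by simp [hp', hp'', State.setReg, vp]) ip
      refine ⟨r', _, .loop_true ?_ (.seq ep (.seq ep' ep'')) er, ?_, vr, cr, ir⟩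
      · simp only [Expr.eval, Op.eval, rd, r1]
        omega
      · rw [Finset.sum_eq_sum_Ico_succ_bot hiN, add_mul]
        simp only [Expr.cost, Expr.eval, Op.eval, rd, r1, vp]
        have q1 := si' i hiN.le
        have q2 := si' (Nv - i) (by omega)
        have q3 := sf (i + 1) hiN
        have q4 := si' (i + 1) hiN
        have q5 : Nat.size 1 = 1 := Nat.size_one
        have q6 : w i * I.Q ^ kb ≤ w i * X := Nat.mul_le_mul_left _ (I.Q_mono kb')
        have q7 : X ≤ w i * X := Nat.le_mul_of_pos_left _ hb.1
        have q8 : w i * (18 * X) = 18 * (w i * X) := by ring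
        omega
  obtain ⟨r, t, er, lr, vr, cr, ir⟩ := loop Nv 0 s3 (by omega)
    (Ctx.le_trans c1 (Ctx.le_trans (Ctx.le_lower (by omega) c2)
      (le_setReg s2 d (d + 1) _ (by omega))))
    (by simpa [hs3, State.setReg] using (c2.2 d (by simp)).trans v1)
    (by simp [hs3, State.setReg]) (by simpa [hs3, State.setReg] using v2) i2
  refine ⟨_, _, .seq e1 (.seq e2 (.seq e3 (.seq er (.assign d (.reg (d + 2)) r)))), ?_, ?_, ?_, ir⟩
  · simp only [Expr.cost, vr]
    rw [← Finset.range_eq_Ico] at lr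
    have q1 : W * I.Q ^ kN ≤ W * X := Nat.mul_le_mul_left _ (I.Q_mono kN')
    have q2 : W * I.Q ^ k0 ≤ W * X := Nat.mul_le_mul_left _ (I.Q_mono k0')
    have q3 : (∑ l ∈ Finset.range Nv, w l) * (18 * X) ≤ 18 * (W * I.Q ^ a * X) :=
      (Nat.mul_le_mul_right _ hw).trans_eq (by ring)
    have q4 : X ≤ W * X := Nat.le_mul_of_pos_left _ hW
    have q5 : W * X ≤ W * I.Q ^ a * X :=
      Nat.mul_le_mul_right _ (Nat.le_mul_of_pos_right _ (I.Q_pos a))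
    have q6 := Nat.mul_le_mul_left W (I.mul_Q_le (c := 32) (j := 5) (by norm_num) (K + a))
    have q7 : W * (32 * I.Q ^ (K + a)) = 32 * (W * I.Q ^ a * X) := by
      rw [hX, pow_add]; ring
    have q8 := sf Nv le_rfl
    omega
  · simp [State.setReg, Expr.eval, vr]
  · exact Ctx.le_trans cr (le_setReg r d d _ le_rfl)

end Logic

end FieldRAM

/-! ### Isotropic decompositions and spanning families -/

section Decompositions

variable {n : ℕ} {F : Type*} [Field F]

/-- `F ^ n` is spanned by `c` isotropic spaces of `𝒜`. -/
def SpannedByIsotropic (𝒜 : Submodule F (Matrix (Fin n) (Fin n) F)) (c : ℕ) : Prop :=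
  ∃ U : Fin c → Submodule F (Fin n → F), (∀ i, IsIsotropicSpace 𝒜 (U i)) ∧ ⨆ i, U i = ⊤

theorem IsIsotropicSpace.anti {𝒜 : Submodule F (Matrix (Fin n) (Fin n) F)}
    {U U' : Submodule F (Fin n → F)} (h : IsIsotropicSpace 𝒜 U) (hU : U' ≤ U) :
    IsIsotropicSpace 𝒜 U' :=
  fun u hu u' hu' A hA => h u (hU hu) u' (hU hu') A hA

theorem SpannedByIsotropic.mono {𝒜 : Submodule F (Matrix (Fin n) (Fin n) F)} {c c' : ℕ}
    (h : SpannedByIsotropic 𝒜 c) (hc : c ≤ c') : SpannedByIsotropic 𝒜 c' := by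
  obtain ⟨U, hU, hs⟩ := h
  refine ⟨fun i => if h : (i : ℕ) < c then U ⟨i, h⟩ else ⊥, fun i => ?_, ?_⟩
  · by_cases h : (i : ℕ) < c
    · simpa [h] using hU _
    · simp only [h, dite_false]
      intro u hu u' _ A _
      rw [(Submodule.mem_bot F).1 hu, zero_dotProduct]
  · rw [eq_top_iff, ← hs]
    refine iSup_le fun i => ?_
    refine le_trans ?_ (le_iSup _ (Fin.castLE hc i))
    simp

/-- A sum of isotropic spaces refines to a direct sum of at most as many nonzero ones: choose a
basis of `F ^ n` inside their union, and group its members. -/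
theorem SpannedByIsotropic.exists_decomposition {𝒜 : Submodule F (Matrix (Fin n) (Fin n) F)}
    {c : ℕ} (h : SpannedByIsotropic 𝒜 c) :
    ∃ c' ≤ c, ∃ U : Fin c' → Submodule F (Fin n → F), IsIsotropicDecomposition 𝒜 U := by
  classical
  obtain ⟨U, hU, hs⟩ := h
  have hspan : ⊤ ≤ Submodule.span F (⋃ i, (U i : Set (Fin n → F))) := by
    rw [← hs]
    exact iSup_le fun i x hx => Submodule.subset_span (Set.mem_iUnion.2 ⟨i, hx⟩)
  let B := Module.Basis.ofSpan hspan
  have hB : ∀ b, ∃ i, B b ∈ U i := by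
    intro b
    have h1 : B b ∈ Set.range B := ⟨b, rfl⟩
    simpa using Module.Basis.ofSpan_subset hspan h1
  choose p hp using hB
  let U' : Fin c → Submodule F (Fin n → F) := fun i => Submodule.span F (B '' {b | p b = i})
  have hU' : ∀ i, U' i ≤ U i := by
    intro i
    refine Submodule.span_le.2 ?_
    rintro _ ⟨b, rfl, rfl⟩
    exact hp b
  have hint : DirectSum.IsInternal U' := by
    rw [DirectSum.isInternal_submodule_iff_iSupIndep_and_iSup_eq_top]
    constructor
    · intro i
      have : ⨆ j, ⨆ (_ : j ≠ i), U' j = Submodule.span F (B '' {b | p b ≠ i}) := by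
        simp only [U', ← Submodule.span_iUnion, ← Set.image_iUnion]
        congr 2
        ext b
        simp
      rw [this]
      refine B.linearIndependent.disjoint_span_image ?_
      rw [Set.disjoint_left]
      intro b hb hb'
      exact hb' hb
    · rw [eq_top_iff, ← B.span_eq, Submodule.span_le]
      rintro _ ⟨b, rfl⟩
      exact Submodule.mem_iSup_of_mem (p b) (Submodule.subset_span ⟨b, rfl, rfl⟩)
  rw [← DirectSum.isInternal_ne_bot_iff] at hint
  let e := Fintype.equivFin {i // U' i ≠ ⊥}
  refine ⟨Fintype.card {i // U' i ≠ ⊥}, ?_, fun j => U' (e.symm j), ?_, ?_, ?_⟩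
  · exact (Fintype.card_subtype_le _).trans_eq (Fintype.card_fin c)
  · exact fun j => (e.symm j).2
  · exact fun j => (hU _).anti (hU' _)
  · rw [DirectSum.isInternal_submodule_iff_iSupIndep_and_iSup_eq_top] at hint ⊢
    refine ⟨hint.1.comp e.symm.injective, ?_⟩
    rw [← hint.2]
    exact e.symm.iSup_comp (g := fun i : {i // U' i ≠ ⊥} => U' i)

theorem spannedByIsotropic_self {𝒜 : Submodule F (Matrix (Fin n) (Fin n) F)}
    (h𝒜 : 𝒜 ≤ alternatingMatrices n F) : SpannedByIsotropic 𝒜 n := by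
  refine ⟨fun i => Submodule.span F {Pi.single i 1}, fun i => ?_, ?_⟩
  · intro u hu u' hu' A hA
    obtain ⟨a, rfl⟩ := Submodule.mem_span_singleton.1 hu
    obtain ⟨a', rfl⟩ := Submodule.mem_span_singleton.1 hu'
    rw [Matrix.mulVec_smul, dotProduct_smul, smul_dotProduct, h𝒜 hA (Pi.single i 1)]
    simp
  · rw [← Submodule.span_iUnion]
    rw [Set.iUnion_singleton_eq_range]
    convert (Pi.basisFun F (Fin n)).span_eq with i
    simp

theorem isotropicDecompositionNumber_le_iff {𝒜 : Submodule F (Matrix (Fin n) (Fin n) F)}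
    (h𝒜 : 𝒜 ≤ alternatingMatrices n F) (c : ℕ) :
    isotropicDecompositionNumber 𝒜 ≤ c ↔ SpannedByIsotropic 𝒜 c := by
  constructor
  · intro h
    obtain ⟨c', -, U, hU⟩ := (spannedByIsotropic_self h𝒜).exists_decomposition
    have hmem : ∃ U : Fin (isotropicDecompositionNumber 𝒜) → Submodule F (Fin n → F),
      IsIsotropicDecomposition 𝒜 U := Nat.sInf_mem
        (s := {c : ℕ | ∃ U : Fin c → Submodule F (Fin n → F), IsIsotropicDecomposition 𝒜 U})
        ⟨c', U, hU⟩
    obtain ⟨U, -, hU, hi⟩ := hmem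
    have hspan : SpannedByIsotropic 𝒜 (isotropicDecompositionNumber 𝒜) :=
      ⟨U, hU, hi.submodule_iSup_eq_top⟩
    exact hspan.mono h
  · intro h
    obtain ⟨c', hc, U, hU⟩ := h.exists_decomposition
    have hmem : c' ∈ {c : ℕ | ∃ U : Fin c → Submodule F (Fin n → F),
      IsIsotropicDecomposition 𝒜 U} := ⟨U, hU⟩
    exact (Nat.sInf_le hmem).trans hc

open Classical in
theorem isotropicDecompositionNumber_eq_sum {𝒜 : Submodule F (Matrix (Fin n) (Fin n) F)}
    (h𝒜 : 𝒜 ≤ alternatingMatrices n F) :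
    isotropicDecompositionNumber 𝒜 =
      ∑ c ∈ Finset.range n, if SpannedByIsotropic 𝒜 c then 0 else 1 := by
  have h1 := (isotropicDecompositionNumber_le_iff h𝒜 n).2 (spannedByIsotropic_self h𝒜)
  simp_rw [← isotropicDecompositionNumber_le_iff h𝒜]
  rw [← Finset.sum_filter_add_sum_filter_not (Finset.range n)
    (fun c => c < isotropicDecompositionNumber 𝒜)]
  rw [Finset.sum_congr rfl (g := fun _ => 1), Finset.sum_congr rfl (g := fun _ => 0)
    (s₁ := Finset.filter (fun x => ¬x < _) _)]
  · have : Finset.filter (fun c => c < isotropicDecompositionNumber 𝒜) (Finset.range n) =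
        Finset.range (isotropicDecompositionNumber 𝒜) := by
      ext c; simp; omega
    simp [this]
  · intro c hc
    have := (Finset.mem_filter.1 hc).2
    simp; omega
  · intro c hc
    have := (Finset.mem_filter.1 hc).2
    simp; omega

end Decompositions

/-! ### Echelon matrices -/

section Echelon

variable {n : ℕ} {F : Type*} [Field F]

/-- Echelon matrices in square form, with pivots in `S` and columns in `S`: the diagonal entries are
`0` or `1`, and an off-diagonal entry `(i, j)` can be nonzero only if `i < j`, the `i`-th diagonal
entry is `1` and the `j`-th one is `0`. The nonzero rows are a reduced echelon basis of the row
space, row `i` having its pivot in column `i`; the matrix is idempotent. -/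
structure IsEchelon (S : Finset (Fin n)) (G : Matrix (Fin n) (Fin n) F) : Prop where
  diag : ∀ i, G i i = 0 ∨ G i i = 1
  row : ∀ i j, i ≠ j → G i j ≠ 0 → i < j ∧ G i i = 1
  col : ∀ i j, i ≠ j → G i j ≠ 0 → G j j = 0
  supp : ∀ i j, j ∉ S → G i j = 0

open Classical in
/-- The set of pivots of an echelon matrix. -/
noncomputable def pivots (G : Matrix (Fin n) (Fin n) F) : Finset (Fin n) :=
  Finset.univ.filter fun i => G i i = 1

theorem mem_pivots {G : Matrix (Fin n) (Fin n) F} {i : Fin n} : i ∈ pivots G ↔ G i i = 1 := by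
  simp [pivots]

open Classical in
/-- The coordinate projection to `S`. -/
noncomputable def coordProj (F : Type*) [Field F] (S : Finset (Fin n)) :
    Matrix (Fin n) (Fin n) F :=
  Matrix.diagonal fun i => if i ∈ S then 1 else 0

open Classical in
theorem coordProj_mul_apply (S : Finset (Fin n)) (M : Matrix (Fin n) (Fin n) F) (i j : Fin n) :
    (coordProj F S * M) i j = if i ∈ S then M i j else 0 := by
  simp [coordProj, Matrix.diagonal_mul]

open Classical in
theorem mul_coordProj_apply (S : Finset (Fin n)) (M : Matrix (Fin n) (Fin n) F) (i j : Fin n) :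
    (M * coordProj F S) i j = if j ∈ S then M i j else 0 := by
  simp [coordProj, Matrix.mul_diagonal]

open Classical in
theorem coordProj_apply (S : Finset (Fin n)) (i j : Fin n) :
    coordProj F S i j = if i = j ∧ i ∈ S then 1 else 0 := by
  simp [coordProj, Matrix.diagonal_apply, ← ite_and]

namespace IsEchelon

variable {S : Finset (Fin n)} {G : Matrix (Fin n) (Fin n) F}

theorem coordProj_mul (h : IsEchelon S G) : coordProj F (pivots G) * G = G := by
  ext i j
  rw [coordProj_mul_apply]
  split_ifs with hi
  · rfl
  · rw [mem_pivots] at hi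
    by_contra h0
    by_cases hij : i = j
    · subst hij
      rcases h.diag i with h1 | h1
      · exact h0 h1.symm
      · exact hi h1
    · exact hi (h.row i j hij (Ne.symm h0)).2

theorem mul_coordProj (h : IsEchelon S G) :
    G * coordProj F (pivots G) = coordProj F (pivots G) := by
  ext i j
  rw [mul_coordProj_apply, coordProj_apply]
  by_cases hj : j ∈ pivots G
  · rw [if_pos hj]
    have hj' := mem_pivots.1 hj
    by_cases hij : i = j
    · subst hij
      simp [hj, hj']
    · rw [if_neg (by tauto)]
      by_contra h0
      rw [h.col i j hij h0] at hj'
      exact zero_ne_one hj'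
  · rw [if_neg hj, if_neg]
    rintro ⟨rfl, h⟩
    exact hj h

theorem mul_self (h : IsEchelon S G) : G * G = G := by
  nth_rw 2 [← h.coordProj_mul]
  rw [← Matrix.mul_assoc, h.mul_coordProj, h.coordProj_mul]

/-- The product of an echelon matrix of coefficients with an echelon basis is echelon. -/
theorem mul {K E : Matrix (Fin n) (Fin n) F} (hE : IsEchelon Finset.univ E)
    (hK : IsEchelon (pivots E) K) : IsEchelon Finset.univ (K * E) := by
  have hin : ∀ i j, j ∈ pivots E → (K * E) i j = K i j := by
    intro i j hj
    have h1 : (K * E * coordProj F (pivots E)) i j = (K * E) i j := by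
      rw [mul_coordProj_apply, if_pos hj]
    rw [← h1, Matrix.mul_assoc, hE.mul_coordProj, mul_coordProj_apply, if_pos hj]
  have hout : ∀ i j, j ∉ pivots E → (K * E) i j ≠ 0 → i < j ∧ K i i = 1 := by
    intro i j hj h0
    rw [Matrix.mul_apply] at h0
    obtain ⟨a, -, ha⟩ := Finset.exists_ne_zero_of_sum_ne_zero h0
    have h1 : K i a ≠ 0 := left_ne_zero_of_mul ha
    have h2 : E a j ≠ 0 := right_ne_zero_of_mul ha
    have haj : a ≠ j := by
      rintro rfl
      rcases hE.diag a with h | h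
      · exact h2 h
      · exact hj (mem_pivots.2 h)
    have h3 := hE.row a j haj h2
    by_cases hia : i = a
    · subst hia
      refine ⟨h3.1, ?_⟩
      rcases hK.diag i with h | h
      · exact absurd h h1
      · exact h
    · have h4 := hK.row i a hia h1
      exact ⟨h4.1.trans h3.1, h4.2⟩
  have hdiag : ∀ i, (K * E) i i = K i i := by
    intro i
    by_cases hi : i ∈ pivots E
    · exact hin i i hi
    · rw [hK.supp i i hi]
      by_contra h0
      exact lt_irrefl _ (hout i i hi h0).1
  refine ⟨fun i => hdiag i ▸ hK.diag i, fun i j hij h0 => ?_, fun i j hij h0 => ?_, by simp⟩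
  · rw [hdiag]
    by_cases hj : j ∈ pivots E
    · exact hK.row i j hij (hin i j hj ▸ h0)
    · exact hout i j hj h0
  · rw [hdiag]
    by_cases hj : j ∈ pivots E
    · exact hK.col i j hij (hin i j hj ▸ h0)
    · exact hK.supp j j hj

/-- An echelon matrix whose rows lie in the row space of `E` has its pivots among those of `E`, and
its coefficients with respect to `E` are found in these columns. -/
theorem restrict {G E : Matrix (Fin n) (Fin n) F} (hE : IsEchelon Finset.univ E)
    (hG : IsEchelon Finset.univ G) (hGE : G * E = G) :
    IsEchelon (pivots E) (G * coordProj F (pivots E)) ∧ G * coordProj F (pivots E) * E = G := by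
  have hpiv : ∀ i, i ∉ pivots E → G i i = 0 := by
    intro i hi
    by_contra h0
    have h1 : (G * E) i i ≠ 0 := by rwa [hGE]
    rw [Matrix.mul_apply] at h1
    obtain ⟨a, -, ha⟩ := Finset.exists_ne_zero_of_sum_ne_zero h1
    have h1 : G i a ≠ 0 := left_ne_zero_of_mul ha
    have h2 : E a i ≠ 0 := right_ne_zero_of_mul ha
    by_cases hai : a = i
    · subst hai
      rcases hE.diag a with h | h
      · exact h2 h
      · exact hi (mem_pivots.2 h)
    · exact lt_asymm (hG.row i a (Ne.symm hai) h1).1 (hE.row a i hai h2).1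
  have hdiag : ∀ i, (G * coordProj F (pivots E)) i i = G i i := by
    intro i
    rw [mul_coordProj_apply]
    split_ifs with hi
    · rfl
    · exact (hpiv i hi).symm
  refine ⟨⟨fun i => hdiag i ▸ hG.diag i, fun i j hij h0 => ?_, fun i j hij h0 => ?_,
    fun i j hj => ?_⟩, ?_⟩
  · rw [hdiag]
    rw [mul_coordProj_apply] at h0
    exact hG.row i j hij (by by_contra h; simp [h] at h0)
  · rw [hdiag]
    rw [mul_coordProj_apply] at h0
    exact hG.col i j hij (by by_contra h; simp [h] at h0)
  · rw [mul_coordProj_apply, if_neg hj]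
  · rw [Matrix.mul_assoc, hE.coordProj_mul, hGE]

end IsEchelon

theorem IsEchelon.pivots_subset {S : Finset (Fin n)} {G : Matrix (Fin n) (Fin n) F}
    (h : IsEchelon S G) : pivots G ⊆ S := by
  intro i hi
  by_contra hS
  rw [mem_pivots, h.supp i i hS] at hi
  exact zero_ne_one hi

theorem coordProj_add_compl (S : Finset (Fin n)) :
    coordProj F S + coordProj F Sᶜ = 1 := by
  classical
  ext i j
  rw [Matrix.add_apply, coordProj_apply, coordProj_apply, Matrix.one_apply]
  by_cases hi : i ∈ S <;> simp [hi]

theorem isUnit_one_sub {N : Matrix (Fin n) (Fin n) F} (hN : ∀ i j, ¬i < j → N i j = 0) :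
    IsUnit (1 - N) := by
  rw [Matrix.isUnit_iff_isUnit_det, Matrix.det_of_isUpperTriangular]
  · simp [hN]
  · intro i j hij
    have hij : j < i := hij
    simp [hN i j hij.not_gt, Matrix.one_apply_ne hij.ne']

/-- Every subspace has a reduced echelon basis. The pivots are the positions of the leading entries
of its vectors; reduced basis vectors are built from the last pivot downwards. -/
theorem exists_isEchelon (U : Submodule F (Fin n → F)) :
    ∃ G : Matrix (Fin n) (Fin n) F, IsEchelon Finset.univ G ∧ (∀ i, G i ∈ U) ∧
      ∀ x ∈ U, x ᵥ* G = x := by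
  classical
  let lead : Fin n → Prop := fun t => ∃ x ∈ U, x t = 1 ∧ ∀ i < t, x i = 0
  have hred : ∀ t, lead t → ∃ g ∈ U, g t = 1 ∧ (∀ i < t, g i = 0) ∧
      ∀ i, lead i → i ≠ t → g i = 0 := by
    intro t
    induction t using WellFoundedGT.induction with
    | _ t ih =>
      rintro ⟨x, hx, hxt, hx0⟩
      choose! g hgU hg1 hg0 hgl using ih
      let s : Finset (Fin n) := Finset.univ.filter fun i => t < i ∧ lead i
      have hs : ∀ i ∈ s, t < i ∧ lead i := by simp [s]
      have hle : ∀ j ≤ t, (∑ i ∈ s, x i • g i) j = 0 := by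
        intro j hj
        rw [Finset.sum_apply]
        refine Finset.sum_eq_zero fun i hi => ?_
        rw [Pi.smul_apply, hg0 i (hs i hi).1 (hs i hi).2 j (hj.trans_lt (hs i hi).1), smul_zero]
      refine ⟨x - ∑ i ∈ s, x i • g i, U.sub_mem hx (U.sum_mem fun i hi =>
        U.smul_mem _ (hgU i (hs i hi).1 (hs i hi).2)), ?_, ?_, ?_⟩
      · rw [Pi.sub_apply, hle t le_rfl, hxt, sub_zero]
      · intro j hj
        rw [Pi.sub_apply, hle j hj.le, hx0 j hj, sub_zero]
      · intro j hj hjt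
        rcases lt_or_gt_of_ne hjt with h | h
        · rw [Pi.sub_apply, hle j h.le, hx0 j h, sub_zero]
        · have hjs : j ∈ s := by simp [s, h, hj]
          rw [Pi.sub_apply, Finset.sum_apply, Finset.sum_eq_single_of_mem j hjs]
          · rw [Pi.smul_apply, hg1 j h hj, smul_eq_mul, mul_one, sub_self]
          · intro i hi hij
            rw [Pi.smul_apply, hgl i (hs i hi).1 (hs i hi).2 j hj hij.symm, smul_zero]
  choose! g hgU hg1 hg0 hgl using hred
  let G : Matrix (Fin n) (Fin n) F := fun i => if lead i then g i else 0
  have hG1 : ∀ i, lead i → G i = g i := fun i hi => if_pos hi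
  have hG0 : ∀ i, ¬lead i → G i = 0 := fun i hi => if_neg hi
  have hGd0 : ∀ i, ¬lead i → G i i = 0 := fun i hi => by rw [hG0 i hi]; rfl
  have hGd1 : ∀ i, lead i → G i i = 1 := fun i hi => by rw [hG1 i hi, hg1 i hi]
  have hGU : ∀ i, G i ∈ U := by
    intro i
    by_cases hi : lead i
    · rw [hG1 i hi]; exact hgU i hi
    · rw [hG0 i hi]; exact U.zero_mem
  have hlead : ∀ i j, G i j ≠ 0 → lead i := by
    intro i j h0
    by_contra hi
    exact h0 (by rw [hG0 i hi]; rfl)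
  refine ⟨G, ⟨fun i => ?_, fun i j hij h0 => ?_, fun i j hij h0 => ?_, by simp⟩, hGU,
    fun x hx => ?_⟩
  · by_cases hi : lead i
    · exact Or.inr (hGd1 i hi)
    · exact Or.inl (hGd0 i hi)
  · have hi := hlead i j h0
    refine ⟨?_, hGd1 i hi⟩
    by_contra hlt
    rw [hG1 i hi] at h0
    exact h0 (hg0 i hi j (lt_of_le_of_ne (not_lt.1 hlt) hij.symm))
  · have hi := hlead i j h0
    by_contra hj
    have hj : lead j := by
      by_contra hj'
      exact hj (hGd0 j hj')
    rw [hG1 i hi] at h0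
    exact h0 (hgl i hi j hj hij.symm)
  · -- `x - x G` lies in `U` and vanishes at all pivots; a nonzero one would have a leading entry
    by_contra hne
    set y := x - x ᵥ* G with hy
    have hyU : y ∈ U := by
      refine U.sub_mem hx ?_
      rw [Matrix.vecMul_eq_sum]
      exact U.sum_mem fun i _ => U.smul_mem _ (hGU i)
    have hy0 : ∀ j, lead j → y j = 0 := by
      intro j hj
      rw [hy, Pi.sub_apply, Matrix.vecMul_eq_sum, Finset.sum_apply,
        Finset.sum_eq_single_of_mem j (Finset.mem_univ j)]
      · simp [hGd1 j hj]
      · intro i _ hij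
        by_cases hi : lead i
        · simp [hG1 i hi, hgl i hi j hj hij.symm]
        · simp [hG0 i hi]
    have hyne : ∃ j, y j ≠ 0 := by
      by_contra h
      push Not at h
      exact hne (sub_eq_zero.1 (funext h : y = 0)).symm
    obtain ⟨j, hj, hmin⟩ := WellFounded.has_min (wellFounded_lt (α := Fin n)) {j | y j ≠ 0} hyne
    refine hj (hy0 j ⟨(y j)⁻¹ • y, U.smul_mem _ hyU, ?_, fun i hi => ?_⟩)
    · simp [inv_mul_cancel₀ (show y j ≠ 0 from hj)]
    · have : y i = 0 := by
        by_contra h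
        exact hmin i h hi
      simp [this]

end Echelon

/-! ### Möbius inversion over the lattice of subspaces -/

section Moebius

open Classical in
/-- The matrices whose nonzero entries lie in the cells `P`. -/
noncomputable def supportedMatrices {n : ℕ} (F : Type*) [Field F] [Fintype F]
    (P : Fin n → Fin n → Prop) : Finset (Matrix (Fin n) (Fin n) F) :=
  Finset.univ.filter fun M => ∀ i j, ¬P i j → M i j = 0

variable {n : ℕ} {F : Type*} [Field F] [Fintype F]

theorem mem_supportedMatrices {P : Fin n → Fin n → Prop} {M : Matrix (Fin n) (Fin n) F} :
    M ∈ supportedMatrices F P ↔ ∀ i j, ¬P i j → M i j = 0 := by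
  simp [supportedMatrices]

open Classical in
/-- The matrix with prescribed entries in the cells `P` and zeros elsewhere. -/
noncomputable def matrixOfCells (P : Fin n → Fin n → Prop)
    (x : {p : Fin n × Fin n // P p.1 p.2} → F) : Matrix (Fin n) (Fin n) F :=
  fun i j => if h : P i j then x ⟨(i, j), h⟩ else 0

open Classical in
theorem sum_matrixOfCells {R : Type*} [AddCommMonoid R] (P : Fin n → Fin n → Prop)
    (g : Matrix (Fin n) (Fin n) F → R) :
    ∑ x : {p : Fin n × Fin n // P p.1 p.2} → F, g (matrixOfCells P x) =
      ∑ M ∈ supportedMatrices F P, g M := by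
  refine Finset.sum_bij (fun x _ => matrixOfCells P x) ?_ ?_ ?_ (fun _ _ => rfl)
  · intro x _
    rw [mem_supportedMatrices]
    intro i j h
    simp [matrixOfCells, h]
  · intro x _ y _ hxy
    funext p
    simpa [matrixOfCells, p.2] using congrFun (congrFun hxy p.1.1) p.1.2
  · intro M hM
    rw [mem_supportedMatrices] at hM
    refine ⟨fun p => M p.1.1 p.1.2, Finset.mem_univ _, ?_⟩
    ext i j
    by_cases h : P i j
    · simp [matrixOfCells, h]
    · simp [matrixOfCells, h, hM i j h]

open Classical in
theorem card_supportedMatrices (P : Fin n → Fin n → Prop) :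
    (supportedMatrices F P).card =
      Fintype.card F ^ (Finset.univ.filter fun p : Fin n × Fin n => P p.1 p.2).card := by
  rw [Finset.card_eq_sum_ones, ← sum_matrixOfCells P fun _ => 1]
  simp [Fintype.card_subtype]

open Classical in
/-- The set of echelon matrices with pivots and columns in `S`. -/
noncomputable def echelonMatrices (F : Type*) [Field F] [Fintype F] (S : Finset (Fin n)) :
    Finset (Matrix (Fin n) (Fin n) F) :=
  Finset.univ.filter fun G => IsEchelon S G

theorem mem_echelonMatrices {S : Finset (Fin n)} {G : Matrix (Fin n) (Fin n) F} :
    G ∈ echelonMatrices F S ↔ IsEchelon S G := by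
  simp [echelonMatrices]

/-- The cells of an echelon matrix with set of pivots `T` that can be filled arbitrarily. -/
def FreeCell (S T : Finset (Fin n)) (i j : Fin n) : Prop :=
  i ∈ T ∧ j ∈ S ∧ j ∉ T ∧ i < j

theorem isEchelon_coordProj_add {S T : Finset (Fin n)} (hT : T ⊆ S)
    {M : Matrix (Fin n) (Fin n) F} (hM : M ∈ supportedMatrices F (FreeCell S T)) :
    IsEchelon S (coordProj F T + M) ∧ pivots (coordProj F T + M) = T := by
  classical
  rw [mem_supportedMatrices] at hM
  have hd : ∀ i, (coordProj F T + M) i i = if i ∈ T then 1 else 0 := by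
    intro i
    rw [Matrix.add_apply, hM i i (fun h => lt_irrefl _ h.2.2.2), coordProj_apply]
    simp
  have ho : ∀ i j, i ≠ j → (coordProj F T + M) i j ≠ 0 → FreeCell S T i j := by
    intro i j hij h0
    rw [Matrix.add_apply, coordProj_apply, if_neg (by tauto), zero_add] at h0
    by_contra h
    exact h0 (hM i j h)
  refine ⟨⟨fun i => ?_, fun i j hij h0 => ?_, fun i j hij h0 => ?_, fun i j hj => ?_⟩, ?_⟩
  · rw [hd]; split_ifs <;> simp
  · rw [hd, if_pos (ho i j hij h0).1]; exact ⟨(ho i j hij h0).2.2.2, rfl⟩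
  · rw [hd, if_neg (ho i j hij h0).2.2.1]
  · by_cases hij : i = j
    · subst hij
      rw [hd, if_neg (fun h => hj (hT h))]
    · by_contra h0
      exact hj (ho i j hij h0).2.1
  · ext i
    rw [mem_pivots, hd]
    split_ifs <;> simp_all

theorem IsEchelon.sub_coordProj_mem {S : Finset (Fin n)} {G : Matrix (Fin n) (Fin n) F}
    (h : IsEchelon S G) :
    G - coordProj F (pivots G) ∈ supportedMatrices F (FreeCell S (pivots G)) := by
  classical
  rw [mem_supportedMatrices]
  intro i j hij
  rw [Matrix.sub_apply, coordProj_apply]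
  by_cases hd : i = j
  · subst hd
    rcases h.diag i with h1 | h1 <;> simp [mem_pivots, h1]
  · rw [if_neg (by tauto), sub_zero]
    by_contra h0
    refine hij ⟨mem_pivots.2 (h.row i j hd h0).2, ?_, ?_, (h.row i j hd h0).1⟩
    · by_contra hj
      exact h0 (h.supp i j hj)
    · rw [mem_pivots, h.col i j hd h0]
      exact zero_ne_one

/-- Echelon matrices are enumerated by their pivots and their free entries. -/
theorem sum_echelonMatrices {R : Type*} [AddCommMonoid R] (S : Finset (Fin n))
    (g : Matrix (Fin n) (Fin n) F → R) :
    ∑ T ∈ S.powerset, ∑ M ∈ supportedMatrices F (FreeCell S T), g (coordProj F T + M) =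
      ∑ G ∈ echelonMatrices F S, g G := by
  rw [Finset.sum_sigma']
  refine Finset.sum_bij' (fun p _ => coordProj F p.1 + p.2)
    (fun G _ => ⟨pivots G, G - coordProj F (pivots G)⟩) ?_ ?_ ?_ ?_ (fun _ _ => rfl)
  · rintro ⟨T, M⟩ h
    rw [Finset.mem_sigma, Finset.mem_powerset] at h
    exact mem_echelonMatrices.2 (isEchelon_coordProj_add h.1 h.2).1
  · intro G hG
    rw [mem_echelonMatrices] at hG
    rw [Finset.mem_sigma, Finset.mem_powerset]
    exact ⟨hG.pivots_subset, hG.sub_coordProj_mem⟩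
  · rintro ⟨T, M⟩ h
    rw [Finset.mem_sigma, Finset.mem_powerset] at h
    have := (isEchelon_coordProj_add h.1 h.2).2
    simp [this]
  · intro G _
    simp

open Classical in
/-- The number of ways to express, on the subspace `X`, the `j`-th coordinate as a linear
combination of the earlier ones. -/
noncomputable def numRelations (X : Submodule F (Fin n → F)) (j : Fin n) : ℕ :=
  (Finset.univ.filter fun m : Fin n → F =>
    (∀ i, ¬i < j → m i = 0) ∧ ∀ x ∈ X, x j = ∑ i, x i * m i).card

theorem numRelations_top (j : Fin n) : numRelations (⊤ : Submodule F (Fin n → F)) j = 0 := by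
  classical
  rw [numRelations, Finset.card_eq_zero, Finset.filter_eq_empty_iff]
  rintro m - ⟨h1, h2⟩
  have := h2 (Pi.single j 1) trivial
  simp [Pi.single_apply, h1 j (lt_irrefl j)] at this

/-- On a proper subspace there is a first coordinate that depends on the earlier ones, and its
dependence is unique. -/
theorem exists_numRelations_eq_one {X : Submodule F (Fin n → F)} (hX : X ≠ ⊤) :
    ∃ j, numRelations X j = 1 := by
  classical
  obtain ⟨φ, hφ, hker⟩ := X.exists_le_ker_of_lt_top (lt_top_iff_ne_top.2 hX)
  let bad : Set (Fin n) := {j | ∃ y : Fin n → F, (∀ x ∈ X, ∑ i, x i * y i = 0) ∧ y j ≠ 0 ∧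
    ∀ i, j < i → y i = 0}
  have hbad : ∀ y : Fin n → F, (∀ x ∈ X, ∑ i, x i * y i = 0) → y ≠ 0 →
      ∃ j ∈ bad, y j ≠ 0 := by
    intro y hy hne
    have : ∃ j, y j ≠ 0 := by
      by_contra h
      push Not at h
      exact hne (funext h)
    obtain ⟨j, hj, hmax⟩ := WellFounded.has_min (wellFounded_gt (α := Fin n)) {j | y j ≠ 0} this
    refine ⟨j, ⟨y, hy, hj, fun i hi => ?_⟩, hj⟩
    by_contra h
    exact hmax i h hi
  have hne : bad.Nonempty := by
    obtain ⟨j, hj, -⟩ := hbad (fun i => φ (Pi.single i 1)) (fun x hx => by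
      have h0 : φ x = 0 := hker hx
      rw [LinearMap.pi_apply_eq_sum_univ] at h0
      rw [← h0]
      exact Finset.sum_congr rfl fun i _ => by
        rw [smul_eq_mul]; congr 2; funext k; simp [Pi.single_apply, eq_comm]) (fun h0 => hφ (by
      refine LinearMap.pi_ext' fun i => LinearMap.ext_ring ?_
      simpa using congrFun h0 i))
    exact ⟨j, hj⟩
  obtain ⟨j, ⟨y, hy, hyj, hy0⟩, hmin⟩ := WellFounded.has_min (wellFounded_lt (α := Fin n)) bad hne
  refine ⟨j, Finset.card_eq_one.2 ⟨fun i => if i < j then -(y j)⁻¹ * y i else 0, ?_⟩⟩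
  have key : (∀ i, ¬i < j → (if i < j then -(y j)⁻¹ * y i else 0) = 0) ∧
      ∀ x ∈ X, x j = ∑ i, x i * (if i < j then -(y j)⁻¹ * y i else 0) := by
    refine ⟨fun i hi => if_neg hi, fun x hx => ?_⟩
    have h1 : ∀ i, x i * (if i < j then -(y j)⁻¹ * y i else 0) =
        (if i = j then x j else 0) - (y j)⁻¹ * (x i * y i) := by
      intro i
      rcases lt_trichotomy i j with h | h | h
      · rw [if_pos h, if_neg h.ne]; ring
      · subst h
        rw [if_neg (lt_irrefl _), if_pos rfl]; field_simp; ring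
      · rw [if_neg h.not_gt, if_neg h.ne', hy0 i h]; ring
    rw [Finset.sum_congr rfl fun i _ => h1 i, Finset.sum_sub_distrib, ← Finset.mul_sum, hy x hx]
    simp
  ext m
  rw [Finset.mem_filter, Finset.mem_singleton]
  constructor
  · rintro ⟨-, h1, h2⟩
    -- the difference of two such dependences would be a dependence of an earlier coordinate
    by_contra hm
    obtain ⟨i, hi, hmi⟩ := hbad (m - fun i => if i < j then -(y j)⁻¹ * y i else 0)
      (fun x hx => by
        simp only [Pi.sub_apply, mul_sub, Finset.sum_sub_distrib]
        rw [← h2 x hx, ← key.2 x hx, sub_self]) (sub_ne_zero.2 hm)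
    have hij : ¬i < j := fun h => hmin i hi h
    simp [h1 i hij, hij] at hmi
  · rintro rfl
    exact ⟨Finset.mem_univ _, key⟩

open Classical in
/-- The number of pairs of non-pivot columns. -/
noncomputable def numPairs (S : Finset (Fin n)) : ℕ :=
  (Finset.univ.filter fun p : Fin n × Fin n => p.1 ∉ S ∧ p.2 ∉ S ∧ p.1 < p.2).card

open Classical in
/-- If every coordinate outside `S` may depend on all earlier ones, the dependences are chosen
independently of each other. -/
theorem card_full_relations (X : Submodule F (Fin n → F)) (S : Finset (Fin n)) :
    ((supportedMatrices F fun i j => j ∉ S ∧ i < j).filter fun M =>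
      ∀ x ∈ X, x ᵥ* (coordProj F Sᶜ - M) = 0).card = ∏ j ∈ Sᶜ, numRelations X j := by
  have h1 : ∏ j ∈ Sᶜ, numRelations X j = (Fintype.piFinset fun j : Fin n => if j ∈ Sᶜ then
      (Finset.univ.filter fun m : Fin n → F =>
        (∀ i, ¬i < j → m i = 0) ∧ ∀ x ∈ X, x j = ∑ i, x i * m i) else {0}).card := by
    rw [Fintype.card_piFinset, ← Finset.prod_subset (Finset.subset_univ Sᶜ)]
    · refine Finset.prod_congr rfl fun j hj => ?_
      rw [if_pos hj]
      rfl
    · intro j _ hj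
      rw [if_neg hj, Finset.card_singleton]
  have h2 : ∀ (M : Matrix (Fin n) (Fin n) F) (x : Fin n → F) (j : Fin n),
      (x ᵥ* (coordProj F Sᶜ - M)) j = (if j ∈ Sᶜ then x j else 0) - ∑ i, x i * M i j := by
    intro M x j
    rw [Matrix.vecMul_sub, Pi.sub_apply]
    congr 1
    simp [coordProj, Matrix.vecMul_diagonal]
  rw [h1]
  refine Finset.card_bij (fun M _ => fun j i => M i j) ?_ ?_ ?_
  · intro M hM
    rw [Finset.mem_filter, mem_supportedMatrices] at hM
    rw [Fintype.mem_piFinset]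
    intro j
    split_ifs with hj
    · rw [Finset.mem_filter]
      refine ⟨Finset.mem_univ _, fun i hi => hM.1 i j fun h => hi h.2, fun x hx => ?_⟩
      have := congrFun (hM.2 x hx) j
      rw [h2, if_pos hj] at this
      exact sub_eq_zero.1 this
    · rw [Finset.mem_singleton]
      funext i
      exact hM.1 i j fun h => hj (Finset.mem_compl.2 h.1)
  · intro M _ M' _ h
    ext i j
    exact congrFun (congrFun h j) i
  · intro m hm
    rw [Fintype.mem_piFinset] at hm
    refine ⟨Matrix.of fun i j => m j i, ?_, rfl⟩
    rw [Finset.mem_filter, mem_supportedMatrices]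
    constructor
    · intro i j hij
      have := hm j
      split_ifs at this with hj
      · rw [Finset.mem_filter] at this
        exact this.2.1 i fun h => hij ⟨Finset.mem_compl.1 hj, h⟩
      · exact congrFun (Finset.mem_singleton.1 this) i
    · intro x hx
      funext j
      rw [h2]
      simp only [Matrix.of_apply]
      have := hm j
      split_ifs at this ⊢ with hj
      · rw [Finset.mem_filter] at this
        exact sub_eq_zero.2 (this.2.2 x hx)
      · simp [Finset.mem_singleton.1 this]

open Classical in
/-- Dependences on all earlier coordinates reduce to dependences on the pivot coordinates by
substitution; the coefficients at earlier non-pivot coordinates are arbitrary. -/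
theorem card_relations_eq (X : Submodule F (Fin n → F)) (S : Finset (Fin n)) :
    Fintype.card F ^ numPairs S * ((echelonMatrices F (Finset.univ : Finset (Fin n))).filter
      fun E => pivots E = S ∧ ∀ x ∈ X, x ᵥ* E = x).card = ∏ j ∈ Sᶜ, numRelations X j := by
  have hcard : Fintype.card F ^ numPairs S =
      (supportedMatrices F fun i j : Fin n => i ∉ S ∧ j ∉ S ∧ i < j).card := by
    rw [card_supportedMatrices, numPairs]
    congr!
  rw [hcard, ← Finset.card_product, ← card_full_relations]
  have hN : ∀ N ∈ supportedMatrices F (fun i j : Fin n => i ∉ S ∧ j ∉ S ∧ i < j),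
      IsUnit (1 - N) ∧ coordProj F Sᶜ * N = N := by
    intro N hN
    rw [mem_supportedMatrices] at hN
    refine ⟨isUnit_one_sub fun i j h => hN i j fun h' => h h'.2.2, ?_⟩
    ext i j
    rw [coordProj_mul_apply]
    split_ifs with hi
    · rfl
    · exact (hN i j fun h => hi (Finset.mem_compl.2 h.1)).symm
  have hφ : ∀ φ ∈ supportedMatrices F (FreeCell Finset.univ S), coordProj F Sᶜ * φ = 0 := by
    intro φ hφ
    rw [mem_supportedMatrices] at hφ
    ext i j
    rw [coordProj_mul_apply, Matrix.zero_apply]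
    split_ifs with hi
    · exact hφ i j fun h => Finset.mem_compl.1 hi h.1
    · rfl
  have hφN : ∀ φ ∈ supportedMatrices F (FreeCell Finset.univ S),
      ∀ N ∈ supportedMatrices F (fun i j : Fin n => i ∉ S ∧ j ∉ S ∧ i < j),
      φ * (1 - N) ∈ supportedMatrices F (FreeCell Finset.univ S) := by
    intro φ hφ N hN
    rw [mem_supportedMatrices] at hφ hN ⊢
    intro i j hij
    rw [Matrix.mul_sub, Matrix.mul_one, Matrix.sub_apply, hφ i j hij, zero_sub, neg_eq_zero,
      Matrix.mul_apply]
    refine Finset.sum_eq_zero fun a _ => ?_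
    by_contra h0
    have h1 : FreeCell Finset.univ S i a := by
      by_contra h
      exact h0 (by rw [hφ i a h, zero_mul])
    have h2 : a ∉ S ∧ j ∉ S ∧ a < j := by
      by_contra h
      exact h0 (by rw [hN a j h, mul_zero])
    exact hij ⟨h1.1, Finset.mem_univ _, h2.2.1, h1.2.2.2.trans h2.2.2⟩
  have hpS : coordProj F Sᶜ = 1 - coordProj F S := by
    rw [← coordProj_add_compl S, add_sub_cancel_left]
  -- `N + (E - D) (1 - N)` is the full matrix, where `D` is the diagonal part of `E`
  have hfact : ∀ N ∈ supportedMatrices F (fun i j : Fin n => i ∉ S ∧ j ∉ S ∧ i < j),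
      ∀ E : Matrix (Fin n) (Fin n) F,
      coordProj F Sᶜ - (N + (E - coordProj F S) * (1 - N)) = (1 - E) * (1 - N) := by
    intro N hNm E
    have h1 : coordProj F S * N = 0 := by
      have := (hN N hNm).2
      rwa [hpS, Matrix.sub_mul, Matrix.one_mul, sub_eq_self] at this
    calc coordProj F Sᶜ - (N + (E - coordProj F S) * (1 - N))
        = (1 - E) * (1 - N) - coordProj F S * N := by rw [hpS]; noncomm_ring
      _ = _ := by rw [h1, sub_zero]
  refine Finset.card_bij (fun p _ => p.1 + (p.2 - coordProj F S) * (1 - p.1)) ?_ ?_ ?_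
  · rintro ⟨N, E⟩ h
    rw [Finset.mem_product, Finset.mem_filter, mem_echelonMatrices] at h
    simp only at h
    obtain ⟨h1, h2, rfl, h3⟩ := h
    simp only
    rw [Finset.mem_filter]
    constructor
    · have h4 := hφN _ h2.sub_coordProj_mem N h1
      rw [mem_supportedMatrices] at h1 h4 ⊢
      intro i j hij
      rw [Matrix.add_apply, h1 i j fun h => hij h.2,
        h4 i j fun h => hij ⟨h.2.2.1, h.2.2.2⟩, add_zero]
    · intro x hx
      have h5 : x ᵥ* (1 - E) = 0 := by rw [Matrix.vecMul_sub, Matrix.vecMul_one, h3 x hx, sub_self]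
      rw [hfact N h1, ← Matrix.vecMul_vecMul, h5, Matrix.zero_vecMul]
  · rintro ⟨N, E⟩ h ⟨N', E'⟩ h' heq
    rw [Finset.mem_product, Finset.mem_filter, mem_echelonMatrices] at h h'
    obtain ⟨h1, h2, h3, -⟩ := h
    obtain ⟨h1', h2', h3', -⟩ := h'
    have hs := h2.sub_coordProj_mem
    have hs' := h2'.sub_coordProj_mem
    simp only [h3, h3'] at heq hs hs' h1 h1'
    have e1 := congrArg (coordProj F Sᶜ * ·) heq
    simp only [Matrix.mul_add, (hN _ h1).2, (hN _ h1').2, ← Matrix.mul_assoc, hφ _ hs, hφ _ hs',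
      Matrix.zero_mul, add_zero] at e1
    subst e1
    have e2 := (hN _ h1).1.mul_right_cancel (add_left_cancel heq)
    rw [sub_left_injective e2]
  · intro M hM
    rw [Finset.mem_filter] at hM
    obtain ⟨hM, hX⟩ := hM
    have hM' := mem_supportedMatrices.1 hM
    have hNm : coordProj F Sᶜ * M ∈
        supportedMatrices F (fun i j : Fin n => i ∉ S ∧ j ∉ S ∧ i < j) := by
      rw [mem_supportedMatrices]
      intro i j hij
      rw [coordProj_mul_apply]
      split_ifs with hi
      · exact hM' i j fun h => hij ⟨Finset.mem_compl.1 hi, h⟩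
      · rfl
    have hψ : coordProj F S * M ∈ supportedMatrices F (FreeCell Finset.univ S) := by
      rw [mem_supportedMatrices]
      intro i j hij
      rw [coordProj_mul_apply]
      split_ifs with hi
      · exact hM' i j fun h => hij ⟨hi, Finset.mem_univ _, h⟩
      · rfl
    set N := coordProj F Sᶜ * M with hNdef
    have hsurj := Finset.surjOn_of_injOn_of_card_le
      (s := supportedMatrices F (FreeCell Finset.univ S)) (fun φ => φ * (1 - N))
      (fun φ h => hφN φ h N hNm) (fun φ _ φ' _ h => (hN N hNm).1.mul_right_cancel h) le_rfl
    obtain ⟨φ, hφm, hφe⟩ := hsurj hψ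
    have hE := isEchelon_coordProj_add (Finset.subset_univ S) hφm
    have hMeq : N + (coordProj F S + φ - coordProj F S) * (1 - N) = M := by
      rw [add_sub_cancel_left]
      simp only at hφe
      rw [hφe, hNdef, ← Matrix.add_mul, add_comm, coordProj_add_compl, Matrix.one_mul]
    refine ⟨(N, coordProj F S + φ), ?_, hMeq⟩
    rw [Finset.mem_product, Finset.mem_filter, mem_echelonMatrices]
    refine ⟨hNm, hE.1, hE.2, fun x hx => ?_⟩
    have h0 := hX x hx
    rw [← hMeq, hfact N hNm, ← Matrix.vecMul_vecMul] at h0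
    have h1 := Matrix.vecMul_injective_of_isUnit (hN N hNm).1 (h0.trans (Matrix.zero_vecMul _).symm)
    rw [Matrix.vecMul_sub, Matrix.vecMul_one] at h1
    exact (sub_eq_zero.1 h1).symm

/-- The value at `W` of the Möbius function of the lattice of subspaces, where `W` is the row space
of an echelon matrix with set of pivots `S`. -/
noncomputable def moebiusWeight (F : Type*) [Fintype F] (S : Finset (Fin n)) : ℤ :=
  (-1) ^ Sᶜ.card * (Fintype.card F : ℤ) ^ numPairs S

open Classical in
/-- Möbius inversion over the lattice of subspaces: summed over the row spaces that contain `X`, the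
weights give `1` if `X` is the whole space, and `0` otherwise. -/
theorem sum_moebiusWeight (X : Submodule F (Fin n → F)) :
    ∑ E ∈ (echelonMatrices F (Finset.univ : Finset (Fin n))).filter fun E => ∀ x ∈ X, x ᵥ* E = x,
      moebiusWeight F (pivots E) = if X = ⊤ then 1 else 0 := by
  have h1 : ∏ j : Fin n, (1 + -(numRelations X j : ℤ)) = if X = ⊤ then 1 else 0 := by
    split_ifs with hX
    · subst hX
      simp [numRelations_top]
    · obtain ⟨j, hj⟩ := exists_numRelations_eq_one hX
      exact Finset.prod_eq_zero (Finset.mem_univ j) (by simp [hj])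
  rw [← h1, Finset.prod_add, Finset.powerset_univ, ← Finset.sum_fiberwise _ pivots]
  refine Finset.sum_congr rfl fun S _ => ?_
  rw [Finset.prod_const_one, one_mul, ← Finset.compl_eq_univ_sdiff, Finset.prod_neg,
    ← Nat.cast_prod, ← card_relations_eq X S, Finset.filter_filter]
  rw [Finset.sum_congr rfl (g := fun _ => moebiusWeight F S)]
  · simp only [Finset.sum_const, moebiusWeight, and_comm, nsmul_eq_mul]
    push_cast
    ring
  · intro E hE
    rw [(Finset.mem_filter.1 hE).2.2]

end Moebius

/-! ### Counting spanning families of isotropic spaces -/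

section Counting

variable {n : ℕ} {F : Type*} [Field F]

/-- The rows of `G` span an isotropic space of `𝒜`. -/
def IsotropicRows (𝒜 : Submodule F (Matrix (Fin n) (Fin n) F)) (G : Matrix (Fin n) (Fin n) F) :
    Prop :=
  ∀ A ∈ 𝒜, G * A * Gᵀ = 0

theorem mul_mul_transpose_apply (G A : Matrix (Fin n) (Fin n) F) (i j : Fin n) :
    (G * A * Gᵀ) i j = G i ⬝ᵥ (A *ᵥ G j) := by
  rw [Matrix.mul_assoc, Matrix.mul_apply]
  rfl

theorem isIsotropicSpace_span {𝒜 : Submodule F (Matrix (Fin n) (Fin n) F)}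
    {G : Matrix (Fin n) (Fin n) F} (h : IsotropicRows 𝒜 G) :
    IsIsotropicSpace 𝒜 (Submodule.span F (Set.range G)) := by
  intro u hu u' hu' A hA
  induction hu using Submodule.span_induction with
  | mem x hx =>
    obtain ⟨i, rfl⟩ := hx
    induction hu' using Submodule.span_induction with
    | mem y hy =>
      obtain ⟨j, rfl⟩ := hy
      rw [← mul_mul_transpose_apply, h A hA]
      rfl
    | zero => simp
    | add y z _ _ hy hz => rw [Matrix.mulVec_add, dotProduct_add, hy, hz, add_zero]
    | smul c y _ hy => rw [Matrix.mulVec_smul, dotProduct_smul, hy, smul_zero]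
  | zero => simp
  | add y z _ _ hy hz => rw [add_dotProduct, hy, hz, add_zero]
  | smul c y _ hy => rw [smul_dotProduct, hy, smul_zero]

variable [Fintype F]

open Classical in
/-- The number of isotropic spaces of `𝒜` inside the row space of the echelon matrix `E`, each of
them given by its echelon matrix of coefficients with respect to the rows of `E`. -/
noncomputable def numIsotropic (𝒜 : Submodule F (Matrix (Fin n) (Fin n) F))
    (E : Matrix (Fin n) (Fin n) F) : ℕ :=
  ((echelonMatrices F (pivots E)).filter fun K => IsotropicRows 𝒜 (K * E)).card

open Classical in
theorem numIsotropic_eq (𝒜 : Submodule F (Matrix (Fin n) (Fin n) F))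
    {E : Matrix (Fin n) (Fin n) F} (hE : IsEchelon Finset.univ E) :
    numIsotropic 𝒜 E = ((echelonMatrices F (Finset.univ : Finset (Fin n))).filter
      fun G => IsotropicRows 𝒜 G ∧ G * E = G).card := by
  refine Finset.card_nbij' (fun K => K * E) (fun G => G * coordProj F (pivots E)) ?_ ?_ ?_ ?_
  · intro K hK
    simp only [Finset.coe_filter, Set.mem_ofPred_eq, mem_echelonMatrices] at hK ⊢
    exact ⟨hE.mul hK.1, hK.2, by rw [Matrix.mul_assoc, hE.mul_self]⟩
  · intro G hG
    simp only [Finset.coe_filter, Set.mem_ofPred_eq, mem_echelonMatrices] at hG ⊢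
    have := hE.restrict hG.1 hG.2.2
    exact ⟨this.1, this.2.symm ▸ hG.2.1⟩
  · intro K hK
    simp only [Finset.coe_filter, Set.mem_ofPred_eq, mem_echelonMatrices] at hK
    simp only
    rw [Matrix.mul_assoc, hE.mul_coordProj]
    ext i j
    rw [mul_coordProj_apply]
    split_ifs with hj
    · rfl
    · exact (hK.1.supp i j hj).symm
  · intro G hG
    simp only [Finset.coe_filter, Set.mem_ofPred_eq, mem_echelonMatrices] at hG
    exact (hE.restrict hG.1 hG.2.2).2

open Classical in
/-- Inclusion-exclusion: the alternating sum counts the `c`-tuples of isotropic spaces that span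
`F ^ n`. -/
theorem sum_moebiusWeight_mul_numIsotropic (𝒜 : Submodule F (Matrix (Fin n) (Fin n) F)) (c : ℕ) :
    ∑ E ∈ echelonMatrices F (Finset.univ : Finset (Fin n)),
      moebiusWeight F (pivots E) * (numIsotropic 𝒜 E : ℤ) ^ c =
    (((Fintype.piFinset fun _ : Fin c => (echelonMatrices F (Finset.univ : Finset (Fin n))).filter
      fun G => IsotropicRows 𝒜 G).filter fun G =>
        ⨆ k, Submodule.span F (Set.range (G k)) = ⊤).card : ℤ) := by
  have h1 : ∀ E ∈ echelonMatrices F (Finset.univ : Finset (Fin n)),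
      moebiusWeight F (pivots E) * (numIsotropic 𝒜 E : ℤ) ^ c =
      ∑ G ∈ Fintype.piFinset fun _ : Fin c =>
        (echelonMatrices F (Finset.univ : Finset (Fin n))).filter fun G => IsotropicRows 𝒜 G,
        if ∀ x ∈ ⨆ k, Submodule.span F (Set.range (G k)), x ᵥ* E = x
          then moebiusWeight F (pivots E) else 0 := by
    intro E hE
    rw [mem_echelonMatrices] at hE
    rw [← Finset.sum_filter, Finset.sum_const, nsmul_eq_mul, mul_comm, numIsotropic_eq 𝒜 hE]
    congr 1
    rw [← Nat.cast_pow]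
    congr 1
    have h2 := Fintype.card_piFinset fun _ : Fin c =>
      ((echelonMatrices F (Finset.univ : Finset (Fin n))).filter
        fun G => IsotropicRows 𝒜 G ∧ G * E = G)
    rw [Finset.prod_const, Finset.card_univ, Fintype.card_fin] at h2
    rw [← h2]
    congr 1
    ext G
    simp only [Fintype.mem_piFinset, Finset.mem_filter]
    have h3 : (∀ x ∈ ⨆ k, Submodule.span F (Set.range (G k)), x ᵥ* E = x) ↔
        ∀ k, G k * E = G k := by
      have h4 : (∀ x ∈ ⨆ k, Submodule.span F (Set.range (G k)), x ᵥ* E = x) ↔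
          ⨆ k, Submodule.span F (Set.range (G k)) ≤
            LinearMap.eqLocus (Matrix.vecMulLinear E) LinearMap.id := Iff.rfl
      rw [h4, iSup_le_iff]
      refine forall_congr' fun k => ?_
      rw [Submodule.span_le]
      constructor
      · intro h
        ext i j
        exact congrFun (h ⟨i, rfl⟩) j
      · rintro h _ ⟨i, rfl⟩
        exact congrFun h i
    rw [h3, ← forall_and]
    exact forall_congr' fun k => and_assoc.symm
  rw [Finset.sum_congr rfl h1, Finset.sum_comm, Finset.card_filter, Nat.cast_sum]
  refine Finset.sum_congr rfl fun G _ => ?_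
  rw [← Finset.sum_filter, sum_moebiusWeight]
  simp

theorem sum_moebiusWeight_pos_iff (𝒜 : Submodule F (Matrix (Fin n) (Fin n) F)) (c : ℕ) :
    0 < ∑ E ∈ echelonMatrices F (Finset.univ : Finset (Fin n)),
      moebiusWeight F (pivots E) * (numIsotropic 𝒜 E : ℤ) ^ c ↔ SpannedByIsotropic 𝒜 c := by
  classical
  rw [sum_moebiusWeight_mul_numIsotropic, Nat.cast_pos, Finset.card_pos]
  constructor
  · rintro ⟨G, hG⟩
    rw [Finset.mem_filter, Fintype.mem_piFinset] at hG
    exact ⟨_, fun k => isIsotropicSpace_span (Finset.mem_filter.1 (hG.1 k)).2, hG.2⟩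
  · rintro ⟨U, hU, hs⟩
    choose G hG hGU hGx using fun k => exists_isEchelon (U k)
    refine ⟨G, ?_⟩
    rw [Finset.mem_filter, Fintype.mem_piFinset]
    refine ⟨fun k => Finset.mem_filter.2 ⟨mem_echelonMatrices.2 (hG k), fun A hA => ?_⟩, ?_⟩
    · ext i j
      rw [mul_mul_transpose_apply]
      exact hU k _ (hGU k i) _ (hGU k j) A hA
    · rw [eq_top_iff, ← hs]
      refine iSup_mono fun k x hx => ?_
      rw [← hGx k x hx, Matrix.vecMul_eq_sum]
      exact Submodule.sum_mem _ fun i _ =>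
        Submodule.smul_mem _ _ (Submodule.subset_span ⟨i, rfl⟩)

end Counting

/-! ### Arithmetic and summation on the machine -/

namespace FieldRAM

section Rules

variable {F : Type*} [Field F] [Fintype F] {I : Setting F} {Γ : Ctx}

theorem comp_add {a b : Code} {x y W k l : ℕ} (ha : Comp I Γ a x W k) (hb : Comp I Γ b y W l) :
    Comp I Γ (opC .add a b) (x + y) W (max k l + 5) := comp_op .add ha hb

theorem comp_sub {a b : Code} {x y W k l : ℕ} (ha : Comp I Γ a x W k) (hb : Comp I Γ b y W l) :
    Comp I Γ (opC .sub a b) (x - y) W (max k l + 5) := comp_op .sub ha hb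

theorem comp_mul {a b : Code} {x y W k l : ℕ} (ha : Comp I Γ a x W k) (hb : Comp I Γ b y W l) :
    Comp I Γ (opC .mul a b) (x * y) W (max k l + 5) := comp_op .mul ha hb

theorem comp_div {a b : Code} {x y W k l : ℕ} (ha : Comp I Γ a x W k) (hb : Comp I Γ b y W l) :
    Comp I Γ (opC .div a b) (x / y) W (max k l + 5) := comp_op .div ha hb

theorem comp_mod {a b : Code} {x y W k l : ℕ} (ha : Comp I Γ a x W k) (hb : Comp I Γ b y W l) :
    Comp I Γ (opC .mod a b) (x % y) W (max k l + 5) := comp_op .mod ha hb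

theorem decode_enc (enc : F ≃ Fin (Fintype.card F)) (x : F) : decode enc (enc x) = x := by
  simp [decode]

theorem comp_fadd {a b : Code} {x y : F} {W k l : ℕ} (ha : Comp I Γ a (I.enc x) W k)
    (hb : Comp I Γ b (I.enc y) W l) :
    Comp I Γ (opC .fadd a b) (I.enc (x + y)) W (max k l + 5) := by
  simpa only [Op.eval, decode_enc] using comp_op .fadd ha hb

theorem comp_fmul {a b : Code} {x y : F} {W k l : ℕ} (ha : Comp I Γ a (I.enc x) W k)
    (hb : Comp I Γ b (I.enc y) W l) :
    Comp I Γ (opC .fmul a b) (I.enc (x * y)) W (max k l + 5) := by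
  simpa only [Op.eval, decode_enc] using comp_op .fmul ha hb

theorem comp_ite_val {c a b : Code} {x v v' W k l : ℕ} (hc : Comp I Γ c x W k)
    (ha : x ≠ 0 → Comp I Γ a v W l) (hb : x = 0 → Comp I Γ b v' W l) :
    Comp I Γ (iteC c a b) (if x = 0 then v' else v) W (max k l + 3) :=
  comp_ite hc (fun h => by simpa [h] using ha h) (fun h => by simpa [h] using hb h)

/-- Test for equality. -/
def eqC (a b : Code) : Code := opC .sub (litC 1) (opC .add (opC .sub a b) (opC .sub b a))

theorem comp_eq {a b : Code} {x y W k l : ℕ} (ha : Comp I Γ a x W k) (hb : Comp I Γ b y W l) :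
    Comp I Γ (eqC a b) (if x = y then 1 else 0) W (max k l + 15) := by
  have h := (comp_sub ((comp_lit 1).mono ha.1 le_rfl)
    (comp_add (comp_sub ha hb) (comp_sub hb ha))).mono (le_refl W)
    (show _ ≤ max k l + 15 by omega)
  have hv : 1 - (x - y + (y - x)) = if x = y then 1 else 0 := by split_ifs <;> omega
  rwa [hv] at h

/-- Comparison. -/
def ltC (a b : Code) : Code := opC .sub (litC 1) (opC .sub (litC 1) (opC .sub b a))

theorem comp_lt {a b : Code} {x y W k l : ℕ} (ha : Comp I Γ a x W k) (hb : Comp I Γ b y W l) :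
    Comp I Γ (ltC a b) (if x < y then 1 else 0) W (max k l + 15) := by
  have h1 := (comp_lit (I := I) (Γ := Γ) 1).mono ha.1 le_rfl
  have h := (comp_sub h1 (comp_sub h1 (comp_sub hb ha))).mono (le_refl W)
    (show _ ≤ max k l + 15 by omega)
  have hv : 1 - (1 - (y - x)) = if x < y then 1 else 0 := by split_ifs <;> omega
  rwa [hv] at h

/-- Negation of a truth value. -/
def notC (a : Code) : Code := opC .sub (litC 1) a

theorem comp_not {a : Code} {x W k : ℕ} (ha : Comp I Γ a x W k) :
    Comp I Γ (notC a) (1 - x) W (k + 8) :=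
  (comp_sub ((comp_lit 1).mono ha.1 le_rfl) ha).mono le_rfl (by omega)

/-- Powers, by repeated multiplication. -/
def powC (x e : Code) : Code := iterC e (litC 1) fun _ acc => opC .mul acc x

theorem size_pow_le (x i : ℕ) : Nat.size (x ^ i) ≤ i * Nat.size x + 1 := by
  induction i with
  | zero => simp
  | succ i ih =>
    rw [pow_succ, add_one_mul]
    have := size_mul_le (x ^ i) x
    omega

theorem comp_pow {x e : Code} {vx ve W k l a : ℕ} (hx : Comp I Γ x vx W k)
    (he : Comp I Γ e ve W l) (hve : ve ≤ I.Q ^ a) :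
    Comp I Γ (powC x e) (vx ^ ve) W (max k l + 2 * a + 14) := by
  have hsize : ∀ i ≤ ve, Nat.size (vx ^ i) ≤ I.Q ^ (a + k + 1) := by
    intro i hi
    have h1 := size_pow_le vx i
    have h2 : i * Nat.size vx ≤ I.Q ^ a * I.Q ^ k := Nat.mul_le_mul (hi.trans hve) hx.size_le
    have h3 := I.mul_Q_le (c := 2) (j := 1) (by norm_num) (a + k)
    have h4 := I.Q_pos (a + k)
    rw [← pow_add] at h2
    omega
  have := comp_iter (body := fun _ acc => opC .mul acc x) (fun i => vx ^ i) (fun _ => W) he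
    (by simpa using (comp_lit 1).mono hx.1 le_rfl) hsize
    (fun i _ Γ' hΓ bi ba _ hacc => by
      rw [pow_succ]
      exact comp_mul (hacc.mono hx.1 le_rfl) (hx.weaken hΓ))
    (a := a) (by simpa [mul_comm] using Nat.mul_le_mul_left W hve)
  exact this.mono le_rfl (by omega)

/-- Sums over `i < N`. -/
def sumC (N : Code) (body : Code → Code) : Code :=
  iterC N (litC 0) fun i acc => opC .add acc (body i)

/-- The rule for sums: the weights of the rounds add up. -/
theorem comp_sum {N : Code} {body : Code → Code} {Nv W k l a : ℕ} (v w : ℕ → ℕ)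
    (hN : Comp I Γ N Nv W k)
    (hbody : ∀ i < Nv, ∀ Γ' : Ctx, Γ ≤ Γ' → ∀ bi : Code, Comp I Γ' bi i 1 (k + 2) →
      Comp I Γ' (body bi) (v i) (w i) l)
    (hw : ∑ i ∈ Finset.range Nv, w i ≤ W * I.Q ^ a) :
    Comp I Γ (sumC N body) (∑ i ∈ Finset.range Nv, v i) W (max k l + a + 14) := by
  have hv : ∀ i < Nv, v i ≤ 2 ^ I.Q ^ l := by
    intro i hi
    have hvar : ∀ i < Nv, Nat.size i ≤ I.Q ^ k := fun i hi =>
      (Nat.size_le_size hi.le).trans hN.size_le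
    -- the size bound needs some context that provides the counter: put it into a fresh register
    have h1 := (hbody i hi ⟨Γ.depth + 1, Function.update Γ.reg (Γ.depth) i⟩
      ⟨Nat.le_succ _, fun x hx => Function.update_of_ne (by omega) _ _⟩
      (varC (Γ.depth)) (by
        have := comp_var (I := I)
          (Γ := ⟨Γ.depth + 1, Function.update Γ.reg (Γ.depth) i⟩)
          (Γ.depth) k (by simp) (by simpa using hvar i hi)
        simpa using this)).size_le
    exact ((Nat.lt_size_self _).trans_le (Nat.pow_le_pow_right (by norm_num) h1)).le
  have hsize : ∀ i ≤ Nv, Nat.size (∑ j ∈ Finset.range i, v j) ≤ I.Q ^ (max k l + 2) := by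
    intro i hi
    have h1 : ∑ j ∈ Finset.range i, v j ≤ Nv * 2 ^ I.Q ^ l := by
      refine (Finset.sum_le_card_nsmul _ _ (2 ^ I.Q ^ l) fun j hj =>
        hv j ((Finset.mem_range.1 hj).trans_le hi)).trans ?_
      rw [Finset.card_range, smul_eq_mul]
      exact Nat.mul_le_mul_right _ hi
    have h2 := Nat.size_le_size h1
    have h3 := size_mul_le Nv (2 ^ I.Q ^ l)
    rw [Nat.size_pow] at h3
    have h4 := hN.size_le
    have h5 := I.Q_mono (le_max_left k l)
    have h6 := I.Q_mono (le_max_right k l)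
    have h7 := I.mul_Q_le (c := 4) (j := 2) (by norm_num) (max k l)
    have h8 := I.Q_pos (max k l)
    omega
  have := comp_iter (body := fun i acc => opC .add acc (body i))
    (fun i => ∑ j ∈ Finset.range i, v j) w hN
    (by simpa using (comp_lit 0).mono hN.1 le_rfl) hsize
    (fun i hi Γ' hΓ bi ba hbi hacc => by
      rw [Finset.sum_range_succ]
      have hb := hbody i hi Γ' hΓ bi hbi
      exact comp_add (hacc.mono hb.1 le_rfl) hb) hw
  exact this.mono le_rfl (by omega)

theorem comp_sum_short {N : Code} {body : Code → Code} {Nv W k l a : ℕ} (v : ℕ → ℕ)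
    (hN : Comp I Γ N Nv W k) (hNv : Nv ≤ I.Q ^ a)
    (hbody : ∀ i < Nv, ∀ Γ' : Ctx, Γ ≤ Γ' → ∀ bi : Code, Comp I Γ' bi i 1 (k + 2) →
      Comp I Γ' (body bi) (v i) W l) :
    Comp I Γ (sumC N body) (∑ i ∈ Finset.range Nv, v i) W (max k l + a + 14) :=
  comp_sum v (fun _ => W) hN hbody (by simpa [mul_comm] using Nat.mul_le_mul_left W hNv)

/-- The zero of the field. -/
def zeroC : Code := opC .fsub (litC 0) (litC 0)

theorem comp_zero : Comp I Γ zeroC (I.enc 0) 1 7 := by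
  simpa [zeroC, Op.eval] using comp_op (I := I) (Γ := Γ) .fsub (comp_lit 0) (comp_lit 0)

/-- The one of the field: `ω / ω` for `ω` one of the codes `0`, `1` that is not the zero. -/
def oneC : Code := opC .fdiv (eqC zeroC (litC 0)) (eqC zeroC (litC 0))

theorem comp_one : Comp I Γ oneC (I.enc 1) 1 27 := by
  have h := comp_eq (I := I) (Γ := Γ) comp_zero (comp_lit 0)
  have h2 := comp_op .fdiv h h
  have h3 : decode I.enc (if (I.enc 0 : ℕ) = 0 then 1 else 0) ≠ 0 := by
    have h1 : 1 < Fintype.card F := Fintype.one_lt_card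
    intro h0
    split_ifs at h0 with hz
    · rw [decode, dif_pos h1, Equiv.symm_apply_eq] at h0
      rw [← h0] at hz
      exact one_ne_zero hz
    · rw [decode, dif_pos (by omega), Equiv.symm_apply_eq] at h0
      rw [← h0] at hz
      exact hz rfl
  simp only [Op.eval, div_self h3] at h2
  exact h2.mono le_rfl (by omega)

/-- Sums in the field over `i < N`. -/
def fsumC (N : Code) (body : Code → Code) : Code :=
  iterC N zeroC fun i acc => opC .fadd acc (body i)

theorem comp_fsum {N : Code} {body : Code → Code} {Nv k l a : ℕ} (v : ℕ → F)
    (hN : Comp I Γ N Nv 1 k) (hNv : Nv ≤ I.Q ^ a)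
    (hbody : ∀ i < Nv, ∀ Γ' : Ctx, Γ ≤ Γ' → ∀ bi : Code, Comp I Γ' bi i 1 (k + 2) →
      Comp I Γ' (body bi) (I.enc (v i)) 1 l) :
    Comp I Γ (fsumC N body) (I.enc (∑ i ∈ Finset.range Nv, v i)) 1 (max k l + a + 20) := by
  have := comp_iter (body := fun i acc => opC .fadd acc (body i)) (kf := 1)
    (fun i => (I.enc (∑ j ∈ Finset.range i, v j) : ℕ)) (fun _ => 1) hN
    (by simpa using comp_zero)
    (fun i _ => by
      have := I.card_le_Q
      have := (I.enc (∑ j ∈ Finset.range i, v j)).2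
      have := size_le_self (I.enc (∑ j ∈ Finset.range i, v j) : ℕ)
      rw [pow_one]
      omega)
    (fun i hi Γ' hΓ bi ba hbi hacc => by
      rw [Finset.sum_range_succ]
      exact comp_fadd hacc (hbody i hi Γ' hΓ bi hbi))
    (a := a) (by simpa using hNv)
  exact this.mono le_rfl (by omega)

end Rules

end FieldRAM

/-! ### The program -/

namespace FieldRAM

section Program

/-- Bit `i` of `s`; the bits of `s < 2 ^ n` describe a subset of `{0, …, n - 1}`. -/
def bitVal (s i : ℕ) : ℕ := s / 2 ^ i % 2

/-- Whether cell number `x = i * n + j` is a free cell for the subsets with codes `s` and `t`. -/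
def cellVal (n s t x : ℕ) : ℕ :=
  bitVal t (x / n) * (bitVal s (x % n) * ((1 - bitVal t (x % n)) *
    if x / n < x % n then 1 else 0))

/-- The number of free cells before cell number `x`. -/
def rankVal (n s t x : ℕ) : ℕ := ∑ y ∈ Finset.range x, cellVal n s t y

/-- The number of pairs of indices outside the subset with code `s`. -/
def pairsVal (n s : ℕ) : ℕ := ∑ x ∈ Finset.range (n * n),
  (1 - bitVal s (x / n)) * ((1 - bitVal s (x % n)) * if x / n < x % n then 1 else 0)

variable {F : Type*} [Field F] [Fintype F]

/-- Entry `(i, j)` of the echelon matrix whose pivots are coded by `t` and whose free entries, in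
columns coded by `s`, are the digits of `z` in base `q`. -/
def echVal (I : Setting F) (s t z i j : ℕ) : F :=
  if i = j then (if bitVal t i = 0 then 0 else 1)
  else if cellVal I.n s t (i * I.n + j) = 0 then 0
  else decode I.enc (z / Fintype.card F ^ rankVal I.n s t (i * I.n + j) % Fintype.card F)

/-- Entry `(i, a)` of the product of the coefficient matrix coded by `(t, y)` with the echelon
matrix coded by `(s, z)`. -/
def prodVal (I : Setting F) (s z t y i a : ℕ) : F :=
  ∑ b ∈ Finset.range I.n, echVal I s t y i b * echVal I (2 ^ I.n - 1) s z b a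

/-- The value of the `l`-th form at the rows `i` and `j` of the product. -/
def formVal (I : Setting F) (A : ℕ → ℕ → ℕ → F) (s z t y l i j : ℕ) : F :=
  ∑ a ∈ Finset.range I.n, ∑ b ∈ Finset.range I.n,
    prodVal I s z t y i a * (A l a b * prodVal I s z t y j b)

/-- The number of forms and pairs of rows at which the rows fail to be isotropic. -/
noncomputable def violVal (I : Setting F) (A : ℕ → ℕ → ℕ → F) (m s z t y : ℕ) : ℕ :=
  open Classical in
  ∑ l ∈ Finset.range m, ∑ i ∈ Finset.range I.n, ∑ j ∈ Finset.range I.n,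
    if formVal I A s z t y l i j = 0 then 0 else 1

/-- The number of elements of the subset `t` outside the subset `s`. -/
def diffVal (n s t : ℕ) : ℕ := ∑ i ∈ Finset.range n, bitVal t i * (1 - bitVal s i)

/-- The number of isotropic spaces inside the row space coded by `(s, z)`. -/
noncomputable def countVal (I : Setting F) (A : ℕ → ℕ → ℕ → F) (m s z : ℕ) : ℕ :=
  ∑ t ∈ Finset.range (2 ^ I.n), if diffVal I.n s t = 0 then
    ∑ y ∈ Finset.range (Fintype.card F ^ rankVal I.n s t (I.n * I.n)),
      if violVal I A m s z t y = 0 then 1 else 0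
  else 0

/-- The number of indices outside the subset with code `s`. -/
def colsVal (n s : ℕ) : ℕ := ∑ i ∈ Finset.range n, (1 - bitVal s i)

/-- The sum of the terms of the inclusion-exclusion formula whose sign is `(-1) ^ p`. -/
noncomputable def termsVal (I : Setting F) (A : ℕ → ℕ → ℕ → F) (m p c : ℕ) : ℕ :=
  ∑ s ∈ Finset.range (2 ^ I.n), if colsVal I.n s % 2 = p then
    Fintype.card F ^ pairsVal I.n s *
      ∑ z ∈ Finset.range (Fintype.card F ^ rankVal I.n (2 ^ I.n - 1) s (I.n * I.n)),
        countVal I A m s z ^ c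
  else 0

/-- The number of `c < n` for which the positive terms do not outweigh the negative ones. -/
noncomputable def answerVal (I : Setting F) (A : ℕ → ℕ → ℕ → F) (m : ℕ) : ℕ :=
  ∑ c ∈ Finset.range I.n, if termsVal I A m 0 c - termsVal I A m 1 c = 0 then 1 else 0

/-- The dimension, the size of the field (`qC`) and the number of forms (`mC`) are read from the
registers in which the input provides them. Each of the codes after them computes the function of
the same name above. -/
def nC : Code := varC 0

def qC : Code := varC 1

def mC : Code := varC 2

def bitC (s i : Code) : Code := opC .mod (opC .div s (powC (litC 2) i)) (litC 2)

def cellC (s t x : Code) : Code :=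
  opC .mul (bitC t (opC .div x nC)) (opC .mul (bitC s (opC .mod x nC))
    (opC .mul (notC (bitC t (opC .mod x nC))) (ltC (opC .div x nC) (opC .mod x nC))))

def rankC (s t x : Code) : Code := sumC x (cellC s t)

def pairsC (s : Code) : Code := sumC (opC .mul nC nC) fun x =>
  opC .mul (notC (bitC s (opC .div x nC))) (opC .mul (notC (bitC s (opC .mod x nC)))
    (ltC (opC .div x nC) (opC .mod x nC)))

def echC (s t z i j : Code) : Code :=
  iteC (eqC i j) (iteC (bitC t i) oneC zeroC)
    (iteC (cellC s t (opC .add (opC .mul i nC) j))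
      (opC .mod (opC .div z (powC qC (rankC s t (opC .add (opC .mul i nC) j)))) qC) zeroC)

/-- The code of the full set of indices. -/
def fullC : Code := opC .sub (powC (litC 2) nC) (litC 1)

def prodC (s z t y i a : Code) : Code :=
  fsumC nC fun b => opC .fmul (echC s t y i b) (echC fullC s z b a)

def formC (s z t y l i j : Code) : Code :=
  fsumC nC fun a => fsumC nC fun b =>
    opC .fmul (prodC s z t y i a) (opC .fmul
      (inpC (opC .add (opC .mul (opC .add (opC .mul l nC) a) nC) b)) (prodC s z t y j b))

def violC (s z t y : Code) : Code :=
  sumC mC fun l => sumC nC fun i => sumC nC fun j => notC (eqC (formC s z t y l i j) zeroC)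

def diffC (s t : Code) : Code := sumC nC fun i => opC .mul (bitC t i) (notC (bitC s i))

def countC (s z : Code) : Code :=
  sumC (powC (litC 2) nC) fun t => iteC (eqC (diffC s t) (litC 0))
    (sumC (powC qC (rankC s t (opC .mul nC nC))) fun y => eqC (violC s z t y) (litC 0)) (litC 0)

def colsC (s : Code) : Code := sumC nC fun i => notC (bitC s i)

def termsC (p c : Code) : Code :=
  sumC (powC (litC 2) nC) fun s => iteC (eqC (opC .mod (colsC s) (litC 2)) p)
    (opC .mul (powC qC (pairsC s))
      (sumC (powC qC (rankC fullC s (opC .mul nC nC))) fun z => powC (countC s z) c)) (litC 0)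

def answerC : Code :=
  sumC nC fun c => eqC (opC .sub (termsC (litC 0) c) (termsC (litC 1) c)) (litC 0)

/-- In the context `Γ`, registers `0`, `1`, `2` hold the parameters of the input. -/
def Base (I : Setting F) (m : ℕ) (Γ : Ctx) : Prop :=
  Comp I Γ nC I.n 1 3 ∧ Comp I Γ qC (Fintype.card F) 1 3 ∧ Comp I Γ mC m 1 5

/-- The input array holds the entries of the matrices `A l`, for `l < m`. -/
def Holds (I : Setting F) (m : ℕ) (A : ℕ → ℕ → ℕ → F) : Prop :=
  ∀ l < m, ∀ i < I.n, ∀ j < I.n, I.inp ((l * I.n + i) * I.n + j) = I.enc (A l i j)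

variable {I : Setting F} {Γ Γ' : Ctx} {m k : ℕ}

theorem Base.weaken (h : Base I m Γ) (hΓ : Γ ≤ Γ') : Base I m Γ' :=
  ⟨h.1.weaken hΓ, h.2.1.weaken hΓ, h.2.2.weaken hΓ⟩

theorem bitVal_le_one (s i : ℕ) : bitVal s i ≤ 1 := by
  unfold bitVal
  omega

theorem mul_le_one_of_le_one {a b : ℕ} (ha : a ≤ 1) (hb : b ≤ 1) : a * b ≤ 1 :=
  Nat.mul_le_mul ha hb

theorem cellVal_le_one (n s t x : ℕ) : cellVal n s t x ≤ 1 := by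
  refine mul_le_one_of_le_one (bitVal_le_one _ _) (mul_le_one_of_le_one (bitVal_le_one _ _)
    (mul_le_one_of_le_one (Nat.sub_le _ _) ?_))
  split_ifs <;> simp

theorem Setting.n_le_Q_pow (I : Setting F) {k : ℕ} (hk : 1 ≤ k) : I.n ≤ I.Q ^ k :=
  I.n_lt_Q.le.trans (Nat.le_self_pow (by omega) _)

theorem Setting.n_mul_n_le_Q (I : Setting F) : I.n * I.n ≤ I.Q ^ 2 := by
  rw [pow_two]
  exact Nat.mul_le_mul I.n_lt_Q.le I.n_lt_Q.le

theorem rankVal_le (n s t x : ℕ) : rankVal n s t x ≤ x := by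
  refine (Finset.sum_le_card_nsmul _ _ 1 fun y _ => cellVal_le_one n s t y).trans ?_
  simp

theorem comp_bit {s i : Code} {sv iv : ℕ} (hs : Comp I Γ s sv 1 k) (hi : Comp I Γ i iv 1 k)
    (hiv : iv ≤ I.Q) : Comp I Γ (bitC s i) (bitVal sv iv) 1 (k + 30) :=
  (comp_mod (comp_div hs (comp_pow (a := 1) (comp_lit 2) hi (by simpa using hiv)))
    (comp_lit 2)).mono le_rfl (by omega)

theorem div_mod_lt {n x : ℕ} (hx : x < n * n) : x / n < n ∧ x % n < n := by
  have hn : 0 < n := by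
    by_contra h
    obtain rfl : n = 0 := by omega
    simp at hx
  exact ⟨Nat.div_lt_of_lt_mul hx, Nat.mod_lt _ hn⟩

theorem comp_cell (hΓ : Base I m Γ) {s t x : Code} {sv tv xv : ℕ} (hs : Comp I Γ s sv 1 k)
    (ht : Comp I Γ t tv 1 k) (hx : Comp I Γ x xv 1 k) (hxv : xv < I.n * I.n) :
    Comp I Γ (cellC s t x) (cellVal I.n sv tv xv) 1 (k + 70) := by
  have hQ := I.n_lt_Q
  have hlt := div_mod_lt hxv
  have hd := (comp_div hx hΓ.1).mono le_rfl (show _ ≤ k + 10 by omega)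
  have hm := (comp_mod hx hΓ.1).mono le_rfl (show _ ≤ k + 10 by omega)
  replace hs := hs.mono le_rfl (show k ≤ k + 10 by omega)
  replace ht := ht.mono le_rfl (show k ≤ k + 10 by omega)
  have hb := comp_bit ht hm (by omega)
  exact (comp_mul (comp_bit ht hd (by omega)) (comp_mul (comp_bit hs hm (by omega))
    (comp_mul (comp_not hb) (comp_lt hd hm)))).mono le_rfl (by omega)

theorem comp_rank (hΓ : Base I m Γ) {s t x : Code} {sv tv xv : ℕ} (hs : Comp I Γ s sv 1 k)
    (ht : Comp I Γ t tv 1 k) (hx : Comp I Γ x xv 1 k) (hxv : xv ≤ I.n * I.n) :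
    Comp I Γ (rankC s t x) (rankVal I.n sv tv xv) 1 (k + 90) :=
  (comp_sum_short (a := 2) (l := k + 72) _ hx (hxv.trans I.n_mul_n_le_Q) fun i hi Γ' h bi hbi =>
    (comp_cell (hΓ.weaken h) ((hs.weaken h).mono le_rfl (show k ≤ k + 2 by omega))
      ((ht.weaken h).mono le_rfl (show k ≤ k + 2 by omega)) hbi (hi.trans_le hxv)).mono le_rfl
      (by omega)).mono le_rfl (by omega)

theorem comp_pairs (hΓ : Base I m Γ) {s : Code} {sv : ℕ} (hs : Comp I Γ s sv 1 k) :
    Comp I Γ (pairsC s) (pairsVal I.n sv) 1 (k + 100) := by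
  refine (comp_sum_short (a := 2) (l := k + 80) _ (comp_mul hΓ.1 hΓ.1) I.n_mul_n_le_Q
    fun i hi Γ' h bi hbi => ?_).mono le_rfl (by omega)
  have hQ := I.n_lt_Q
  have hlt := div_mod_lt hi
  have hn := hΓ.1.weaken h
  have hd := (comp_div hbi hn).mono le_rfl (show _ ≤ k + 20 by omega)
  have hm := (comp_mod hbi hn).mono le_rfl (show _ ≤ k + 20 by omega)
  replace hs := (hs.weaken h).mono le_rfl (show k ≤ k + 20 by omega)
  exact (comp_mul (comp_not (comp_bit hs hd (by omega)))
    (comp_mul (comp_not (comp_bit hs hm (by omega))) (comp_lt hd hm))).mono le_rfl (by omega)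

theorem cell_lt {n i j : ℕ} (hi : i < n) (hj : j < n) : i * n + j < n * n := by
  nlinarith

theorem comp_ech (hΓ : Base I m Γ) {s t z i j : Code} {sv tv zv iv jv : ℕ}
    (hs : Comp I Γ s sv 1 k) (ht : Comp I Γ t tv 1 k) (hz : Comp I Γ z zv 1 k)
    (hi : Comp I Γ i iv 1 k) (hj : Comp I Γ j jv 1 k) (hiv : iv < I.n) (hjv : jv < I.n) :
    Comp I Γ (echC s t z i j) (I.enc (echVal I sv tv zv iv jv)) 1 (k + 160) := by
  have hQ := I.n_lt_Q
  have hx := (comp_add (comp_mul hi hΓ.1) hj).mono le_rfl (show _ ≤ k + 20 by omega)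
  have hxv := cell_lt hiv hjv
  have hs' := hs.mono le_rfl (show k ≤ k + 20 by omega)
  have ht' := ht.mono le_rfl (show k ≤ k + 20 by omega)
  have hr := comp_rank hΓ hs' ht' hx hxv.le
  have hdig := comp_mod (comp_div hz (comp_pow (a := 2) hΓ.2.1 hr
    ((rankVal_le _ _ _ _).trans (hxv.le.trans I.n_mul_n_le_Q)))) hΓ.2.1
  have hq : 0 < Fintype.card F := Fintype.card_pos
  have henc : ∀ a, (I.enc (decode I.enc (a % Fintype.card F)) : ℕ) = a % Fintype.card F := by
    intro a
    rw [decode, dif_pos (Nat.mod_lt _ hq), Equiv.apply_symm_apply]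
  rw [← henc] at hdig
  have := comp_ite_val (comp_eq hi hj)
    (l := k + 150) (fun _ => (comp_ite_val (comp_bit ht hi (by omega))
      (fun _ => comp_one) (fun _ => comp_zero.mono le_rfl (by omega))).mono le_rfl (by omega))
    (fun _ => (comp_ite_val (comp_cell hΓ hs' ht' hx hxv)
      (fun _ => hdig) (fun _ => comp_zero.mono le_rfl (by omega))).mono le_rfl (by omega))
  unfold echC
  convert this.mono le_rfl (show _ ≤ k + 160 by omega) using 1
  unfold echVal
  split_ifs <;> simp_all

theorem comp_full (hΓ : Base I m Γ) : Comp I Γ fullC (2 ^ I.n - 1) 1 25 :=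
  (comp_sub (comp_pow (a := 1) (comp_lit 2) hΓ.1 (I.n_le_Q_pow le_rfl))
    (comp_lit 1)).mono le_rfl (by omega)

theorem comp_prod (hΓ : Base I m Γ) {s z t y i a : Code} {sv zv tv yv iv av : ℕ}
    (hs : Comp I Γ s sv 1 k) (hz : Comp I Γ z zv 1 k) (ht : Comp I Γ t tv 1 k)
    (hy : Comp I Γ y yv 1 k) (hi : Comp I Γ i iv 1 k) (ha : Comp I Γ a av 1 k)
    (hiv : iv < I.n) (hav : av < I.n) :
    Comp I Γ (prodC s z t y i a) (I.enc (prodVal I sv zv tv yv iv av)) 1 (k + 220) := by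
  refine (comp_fsum (a := 1) (l := k + 195) _ hΓ.1 (I.n_le_Q_pow le_rfl)
    fun b hb Γ' h bi hbi => ?_).mono le_rfl (by omega)
  have hk : k ≤ k + 25 := by omega
  replace hs := (hs.weaken h).mono le_rfl hk
  replace hz := (hz.weaken h).mono le_rfl hk
  replace ht := (ht.weaken h).mono le_rfl hk
  replace hy := (hy.weaken h).mono le_rfl hk
  replace hi := (hi.weaken h).mono le_rfl hk
  replace ha := (ha.weaken h).mono le_rfl hk
  replace hbi := hbi.mono le_rfl (show _ ≤ k + 25 by omega)
  have hfull := (comp_full (hΓ.weaken h)).mono le_rfl (show _ ≤ k + 25 by omega)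
  exact (comp_fmul (comp_ech (hΓ.weaken h) hs ht hy hi hbi hiv hb)
    (comp_ech (hΓ.weaken h) hfull hs hz hbi ha hb hav)).mono le_rfl (by omega)

theorem comp_form (hΓ : Base I m Γ) {A : ℕ → ℕ → ℕ → F} (hA : Holds I m A)
    {s z t y l i j : Code} {sv zv tv yv lv iv jv : ℕ}
    (hs : Comp I Γ s sv 1 k) (hz : Comp I Γ z zv 1 k) (ht : Comp I Γ t tv 1 k)
    (hy : Comp I Γ y yv 1 k) (hl : Comp I Γ l lv 1 k) (hi : Comp I Γ i iv 1 k)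
    (hj : Comp I Γ j jv 1 k) (hlv : lv < m) (hiv : iv < I.n) (hjv : jv < I.n) :
    Comp I Γ (formC s z t y l i j) (I.enc (formVal I A sv zv tv yv lv iv jv)) 1 (k + 300) := by
  refine (comp_fsum (a := 1) (l := k + 275) _ hΓ.1 (I.n_le_Q_pow le_rfl)
    fun a ha Γ' h ac hac => ?_).mono le_rfl (by omega)
  refine (comp_fsum (a := 1) (l := k + 245) _ (hΓ.weaken h).1 (I.n_le_Q_pow le_rfl)
    fun b hb Γ'' h' bc hbc => ?_).mono le_rfl (by omega)
  have hk : k ≤ k + 5 := by omega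
  have h'' := Ctx.le_trans h h'
  replace hs := (hs.weaken h'').mono le_rfl hk
  replace hz := (hz.weaken h'').mono le_rfl hk
  replace ht := (ht.weaken h'').mono le_rfl hk
  replace hy := (hy.weaken h'').mono le_rfl hk
  replace hl := (hl.weaken h'').mono le_rfl hk
  replace hi := (hi.weaken h'').mono le_rfl hk
  replace hj := (hj.weaken h'').mono le_rfl hk
  replace hac := (hac.weaken h').mono le_rfl (show _ ≤ k + 5 by omega)
  replace hbc := hbc.mono le_rfl (show _ ≤ k + 5 by omega)
  have hΓ'' := hΓ.weaken h''
  have hval := hA lv hlv a ha b hb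
  have hinp := comp_inp (comp_add (comp_mul (comp_add (comp_mul hl hΓ''.1) hac) hΓ''.1) hbc)
    (l := 1) (by
      rw [hval, pow_one]
      exact ((size_le_self _).trans (I.enc (A lv a b)).2.le).trans I.card_le_Q)
  rw [hval] at hinp
  exact (comp_fmul (comp_prod hΓ'' hs hz ht hy hi hac hiv ha)
    (comp_fmul hinp (comp_prod hΓ'' hs hz ht hy hj hbc hjv hb))).mono le_rfl (by omega)

theorem comp_viol (hΓ : Base I m Γ) (hm : m ≤ I.Q ^ 2) {A : ℕ → ℕ → ℕ → F} (hA : Holds I m A)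
    {s z t y : Code} {sv zv tv yv : ℕ}
    (hs : Comp I Γ s sv 1 k) (hz : Comp I Γ z zv 1 k) (ht : Comp I Γ t tv 1 k)
    (hy : Comp I Γ y yv 1 k) :
    Comp I Γ (violC s z t y) (violVal I A m sv zv tv yv) 1 (k + 410) := by
  refine (comp_sum_short (a := 2) (l := k + 380) _ hΓ.2.2 hm
    fun l hl Γ₁ h₁ lc hlc => ?_).mono le_rfl (by omega)
  refine (comp_sum_short (a := 1) (l := k + 360) _ (hΓ.weaken h₁).1 (I.n_le_Q_pow le_rfl)
    fun i hi Γ₂ h₂ ic hic => ?_).mono le_rfl (by omega)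
  have h₁₂ := Ctx.le_trans h₁ h₂
  refine (comp_sum_short (a := 1) (l := k + 340) _ (hΓ.weaken h₁₂).1 (I.n_le_Q_pow le_rfl)
    fun j hj Γ₃ h₃ jc hjc => ?_).mono le_rfl (by omega)
  have h := Ctx.le_trans h₁₂ h₃
  have hk : k ≤ k + 10 := by omega
  replace hs := (hs.weaken h).mono le_rfl hk
  replace hz := (hz.weaken h).mono le_rfl hk
  replace ht := (ht.weaken h).mono le_rfl hk
  replace hy := (hy.weaken h).mono le_rfl hk
  replace hlc := ((hlc.weaken h₂).weaken h₃).mono le_rfl (show _ ≤ k + 10 by omega)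
  replace hic := (hic.weaken h₃).mono le_rfl (show _ ≤ k + 10 by omega)
  replace hjc := hjc.mono le_rfl (show _ ≤ k + 10 by omega)
  have := (comp_not (comp_eq (comp_form (hΓ.weaken h) hA hs hz ht hy hlc hic hjc hl hi hj)
    comp_zero)).mono le_rfl (show _ ≤ k + 340 by omega)
  convert this using 1
  have hiff : (I.enc (formVal I A sv zv tv yv l i j) : ℕ) = I.enc 0 ↔
      formVal I A sv zv tv yv l i j = 0 := by
    rw [Fin.val_inj, EmbeddingLike.apply_eq_iff_eq]
  by_cases h0 : formVal I A sv zv tv yv l i j = 0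
  · rw [if_pos h0, if_pos (hiff.2 h0)]
  · rw [if_neg h0, if_neg fun h => h0 (hiff.1 h)]

theorem comp_diff (hΓ : Base I m Γ) {s t : Code} {sv tv : ℕ} (hs : Comp I Γ s sv 1 k)
    (ht : Comp I Γ t tv 1 k) : Comp I Γ (diffC s t) (diffVal I.n sv tv) 1 (k + 80) := by
  refine (comp_sum_short (a := 1) (l := k + 60) _ hΓ.1 (I.n_le_Q_pow le_rfl)
    fun i hi Γ' h ic hic => ?_).mono le_rfl (by omega)
  have hQ := I.n_lt_Q
  replace hs := (hs.weaken h).mono le_rfl (show k ≤ k + 5 by omega)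
  replace ht := (ht.weaken h).mono le_rfl (show k ≤ k + 5 by omega)
  replace hic := hic.mono le_rfl (show _ ≤ k + 5 by omega)
  exact (comp_mul (comp_bit ht hic (by omega))
    (comp_not (comp_bit hs hic (by omega)))).mono le_rfl (by omega)

theorem comp_cols (hΓ : Base I m Γ) {s : Code} {sv : ℕ} (hs : Comp I Γ s sv 1 k) :
    Comp I Γ (colsC s) (colsVal I.n sv) 1 (k + 80) := by
  refine (comp_sum_short (a := 1) (l := k + 60) _ hΓ.1 (I.n_le_Q_pow le_rfl)
    fun i hi Γ' h ic hic => ?_).mono le_rfl (by omega)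
  have hQ := I.n_lt_Q
  replace hs := (hs.weaken h).mono le_rfl (show k ≤ k + 5 by omega)
  replace hic := hic.mono le_rfl (show _ ≤ k + 5 by omega)
  exact (comp_not (comp_bit hs hic (by omega))).mono le_rfl (by omega)

theorem Setting.two_pow_n_le_Q (I : Setting F) : 2 ^ I.n ≤ I.Q ^ 1 := by
  rw [pow_one]
  exact (Nat.pow_le_pow_left Fintype.one_lt_card _).trans
    (Nat.pow_le_pow_right Fintype.card_pos (by omega))

/-- The number of rounds is dominated by the number of coefficient matrices. -/
theorem comp_count (hΓ : Base I m Γ) (hm : m ≤ I.Q ^ 2) {A : ℕ → ℕ → ℕ → F} (hA : Holds I m A)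
    {s z : Code} {sv zv W : ℕ} (hs : Comp I Γ s sv 1 k) (hz : Comp I Γ z zv 1 k) (hW : 1 ≤ W)
    (hW' : ∀ tv < 2 ^ I.n, diffVal I.n sv tv = 0 →
      Fintype.card F ^ rankVal I.n sv tv (I.n * I.n) ≤ W) :
    Comp I Γ (countC s z) (countVal I A m sv zv) W (k + 640) := by
  refine (comp_sum_short (a := 1) (l := k + 620) _
    ((comp_pow (a := 1) (comp_lit 2) hΓ.1 (I.n_le_Q_pow le_rfl)).mono hW le_rfl)
    I.two_pow_n_le_Q fun t ht Γ₁ h₁ tc htc => ?_).mono le_rfl (by omega)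
  have hk : k ≤ k + 30 := by omega
  have hs₁ := (hs.weaken h₁).mono le_rfl hk
  have htc₁ := htc.mono le_rfl (show _ ≤ k + 30 by omega)
  have hΓ₁ := hΓ.weaken h₁
  have hnn := (comp_mul hΓ₁.1 hΓ₁.1).mono le_rfl (show _ ≤ k + 30 by omega)
  have hcond := ((comp_eq (comp_diff hΓ₁ hs₁ htc₁) (comp_lit 0)).mono hW
    (show _ ≤ k + 130 by omega))
  have hlen := comp_pow (a := 2) hΓ₁.2.1 (comp_rank hΓ₁ hs₁ htc₁ hnn le_rfl)
    ((rankVal_le _ _ _ _).trans I.n_mul_n_le_Q)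
  have key : diffVal I.n sv t = 0 → Comp I Γ₁ (sumC (powC qC (rankC s tc (opC .mul nC nC)))
      fun y => eqC (violC s z tc y) (litC 0))
      (∑ y ∈ Finset.range (Fintype.card F ^ rankVal I.n sv t (I.n * I.n)),
        if violVal I A m sv zv t y = 0 then 1 else 0) W (k + 615) := by
    intro hd
    refine (comp_sum (a := 0) (l := k + 590) _ (fun _ => 1)
      ((hlen.mono hW (show _ ≤ k + 140 by omega))) (fun y hy Γ₂ h₂ yc hyc => ?_)
      (by simpa using hW' t ht hd)).mono le_rfl (by omega)
    have hk' : k ≤ k + 142 := by omega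
    have h := Ctx.le_trans h₁ h₂
    exact (comp_eq (comp_viol (hΓ.weaken h) hm hA ((hs.weaken h).mono le_rfl hk')
      ((hz.weaken h).mono le_rfl hk') ((htc.weaken h₂).mono le_rfl (by omega)) hyc)
      (comp_lit 0)).mono le_rfl (by omega)
  refine (comp_ite hcond (l := k + 615) (fun hne => ?_) (fun he => ?_)).mono le_rfl (by omega)
  · have hd : diffVal I.n sv t = 0 := by
      by_contra h
      simp [h] at hne
    rw [if_pos hd]
    exact key hd
  · have hd : diffVal I.n sv t ≠ 0 := by
      intro h
      simp [h] at he
    rw [if_neg hd]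
    exact (comp_lit 0).mono hW (by omega)

/-- The rounds over all row spaces multiply with those over the coefficient matrices. -/
theorem comp_terms (hΓ : Base I m Γ) (hm : m ≤ I.Q ^ 2) {A : ℕ → ℕ → ℕ → F} (hA : Holds I m A)
    {p c : Code} {pv cv W : ℕ} (hp : Comp I Γ p pv 1 k) (hc : Comp I Γ c cv 1 k) (hcv : cv ≤ I.n)
    (hW : 1 ≤ W) (w : ℕ → ℕ) (hw : ∀ sv, 1 ≤ w sv)
    (hw' : ∀ sv < 2 ^ I.n, ∀ tv < 2 ^ I.n, diffVal I.n sv tv = 0 →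
      Fintype.card F ^ rankVal I.n sv tv (I.n * I.n) ≤ w sv)
    (hW' : ∀ sv < 2 ^ I.n,
      Fintype.card F ^ rankVal I.n (2 ^ I.n - 1) sv (I.n * I.n) * w sv ≤ W) :
    Comp I Γ (termsC p c) (termsVal I A m pv cv) W (k + 1000) := by
  refine (comp_sum_short (a := 1) (l := k + 950) _
    ((comp_pow (a := 1) (comp_lit 2) hΓ.1 (I.n_le_Q_pow le_rfl)).mono hW le_rfl)
    I.two_pow_n_le_Q fun s hs Γ₁ h₁ sc hsc => ?_).mono le_rfl (by omega)
  have hsc₁ := hsc.mono le_rfl (show _ ≤ k + 30 by omega)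
  have hΓ₁ := hΓ.weaken h₁
  have hnn := (comp_mul hΓ₁.1 hΓ₁.1).mono le_rfl (show _ ≤ k + 30 by omega)
  have hfull := (comp_full hΓ₁).mono le_rfl (show _ ≤ k + 30 by omega)
  have hcond := ((comp_eq (comp_mod (comp_cols hΓ₁ hsc₁) (comp_lit 2)) (hp.weaken h₁)).mono hW
    (show _ ≤ k + 140 by omega))
  have hpairs : pairsVal I.n s ≤ I.n * I.n := by
    refine (Finset.sum_le_card_nsmul _ _ 1 fun x _ => mul_le_one_of_le_one (Nat.sub_le _ _)
      (mul_le_one_of_le_one (Nat.sub_le _ _) ?_)).trans (by simp)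
    split_ifs <;> simp
  have hlen := comp_pow (a := 2) hΓ₁.2.1 (comp_rank hΓ₁ hfull hsc₁ hnn le_rfl)
    ((rankVal_le _ _ _ _).trans I.n_mul_n_le_Q)
  have hweight := (comp_pow (a := 2) hΓ₁.2.1 (comp_pairs hΓ₁ hsc₁)
    (hpairs.trans I.n_mul_n_le_Q)).mono hW (show _ ≤ k + 150 by omega)
  have hsum := comp_sum (body := fun z => powC (countC sc z) c) (a := 0) (l := k + 850)
    (fun z => countVal I A m s z ^ cv) (fun _ => w s)
    ((hlen.mono hW (show _ ≤ k + 150 by omega))) (fun z hz Γ₂ h₂ zc hzc => by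
      have hk' : k ≤ k + 152 := by omega
      have h := Ctx.le_trans h₁ h₂
      have hcount := comp_count (hΓ.weaken h) hm hA
        ((hsc.weaken h₂).mono le_rfl (show _ ≤ k + 152 by omega)) hzc (hw s) (hw' s hs)
      exact (comp_pow (a := 1) hcount ((hc.weaken h).mono (hw s) hk')
        (hcv.trans (I.n_le_Q_pow le_rfl))).mono le_rfl (by omega))
    (by simpa using hW' s hs)
  have hmain := (comp_mul hweight hsum).mono le_rfl (show _ ≤ k + 900 by omega)
  refine (comp_ite hcond (l := k + 900) (fun hne => ?_) (fun he => ?_)).mono le_rfl (by omega)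
  · have hd : colsVal I.n s % 2 = pv := by
      by_contra h
      simp [h] at hne
    rw [if_pos hd]
    exact hmain
  · have hd : colsVal I.n s % 2 ≠ pv := by
      intro h
      simp [h] at he
    rw [if_neg hd]
    exact (comp_lit 0).mono hW (by omega)

theorem comp_answer (hΓ : Base I m Γ) (hm : m ≤ I.Q ^ 2) {A : ℕ → ℕ → ℕ → F} (hA : Holds I m A)
    {W : ℕ} (hW : 1 ≤ W) (w : ℕ → ℕ) (hw : ∀ sv, 1 ≤ w sv)
    (hw' : ∀ sv < 2 ^ I.n, ∀ tv < 2 ^ I.n, diffVal I.n sv tv = 0 →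
      Fintype.card F ^ rankVal I.n sv tv (I.n * I.n) ≤ w sv)
    (hW' : ∀ sv < 2 ^ I.n,
      Fintype.card F ^ rankVal I.n (2 ^ I.n - 1) sv (I.n * I.n) * w sv ≤ W) :
    Comp I Γ answerC (answerVal I A m) W 1050 := by
  refine (comp_sum_short (a := 1) (l := 1030) _ (hΓ.1.mono hW le_rfl) (I.n_le_Q_pow le_rfl)
    fun c hc Γ₁ h₁ cc hcc => ?_).mono le_rfl (by omega)
  have hT : ∀ p : ℕ, p ≤ 1 → Comp I Γ₁ (termsC (litC p) cc) (termsVal I A m p c) W 1005 :=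
    fun p hp => (comp_terms (k := 5) (hΓ.weaken h₁) hm hA ((comp_lit p).mono le_rfl (by omega))
      (hcc.mono le_rfl (by omega)) hc.le hW w hw hw' hW').mono le_rfl (by omega)
  exact (comp_eq (comp_sub (hT 0 (by omega)) (hT 1 le_rfl))
    ((comp_lit 0).mono hW le_rfl)).mono le_rfl (by omega)

end Program

end FieldRAM

/-! ### The numbers computed by the program -/

namespace FieldRAM

section Decoding

theorem sum_range_pow_eq {R : Type*} [AddCommMonoid R] (b N : ℕ) (h : ℕ → R) :
    ∑ z ∈ Finset.range (b ^ N), h z =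
      ∑ f : Fin N → Fin b, h (finFunctionFinEquiv f : Fin (b ^ N)) := by
  rw [Finset.sum_range, ← Equiv.sum_comp finFunctionFinEquiv]

theorem finFunctionFinEquiv_div_mod {b N : ℕ} (f : Fin N → Fin b) (i : Fin N) :
    ((finFunctionFinEquiv f : Fin (b ^ N)) : ℕ) / b ^ (i : ℕ) % b = f i := by
  conv_rhs => rw [← finFunctionFinEquiv.symm_apply_apply f]
  rw [finFunctionFinEquiv_symm_apply_val]

/-- The subset of `Fin n` with code `s`. -/
def bitSet (n s : ℕ) : Finset (Fin n) := Finset.univ.filter fun i => bitVal s i = 1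

theorem bitVal_eq (n s : ℕ) (i : Fin n) : bitVal s i = if i ∈ bitSet n s then 1 else 0 := by
  have := bitVal_le_one s i
  simp only [bitSet, Finset.mem_filter, Finset.mem_univ, true_and]
  split_ifs <;> omega

theorem sum_bitSet {R : Type*} [AddCommMonoid R] (n : ℕ) (g : Finset (Fin n) → R) :
    ∑ s ∈ Finset.range (2 ^ n), g (bitSet n s) = ∑ S, g S := by
  rw [sum_range_pow_eq 2 n fun s => g (bitSet n s)]
  refine Finset.sum_bij' (fun f _ => Finset.univ.filter fun i => f i = 1)
    (fun S _ i => if i ∈ S then 1 else 0) (by simp) (by simp) ?_ ?_ ?_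
  · intro f _
    funext i
    have : f i = 0 ∨ f i = 1 := by
      have := (f i).2
      simp only [Fin.ext_iff, Fin.val_zero, Fin.val_one]
      omega
    rcases this with h | h <;> simp [h]
  · intro S _
    ext i
    simp
  · intro f _
    congr 1
    ext i
    simp only [bitSet, bitVal, finFunctionFinEquiv_div_mod, Finset.mem_filter, Finset.mem_univ,
      true_and, Fin.ext_iff, Fin.val_one]

theorem bitSet_full (n : ℕ) : bitSet n (2 ^ n - 1) = Finset.univ := by
  ext i
  have h := Nat.testBit_two_pow_sub_one n i
  rw [Nat.testBit_eq_decide_div_mod_eq] at h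
  have hi : bitVal (2 ^ n - 1) i = 1 := by simpa [bitVal] using h
  simp [bitSet, hi]

theorem cell_div {n : ℕ} (i j : Fin n) : ((i : ℕ) * n + j) / n = i ∧ ((i : ℕ) * n + j) % n = j := by
  have hn : 0 < n := i.pos
  constructor
  · rw [mul_comm, Nat.mul_add_div hn, Nat.div_eq_of_lt j.2, add_zero]
  · rw [mul_comm, Nat.mul_add_mod, Nat.mod_eq_of_lt j.2]

theorem sum_range_mul_self (n : ℕ) (f : ℕ → ℕ) :
    ∑ x ∈ Finset.range (n * n), f x = ∑ p : Fin n × Fin n, f ((p.1 : ℕ) * n + p.2) := by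
  rw [Finset.sum_range, ← Equiv.sum_comp finProdFinEquiv]
  refine Finset.sum_congr rfl fun p _ => ?_
  congr 1
  simp only [finProdFinEquiv_apply_val]
  ring

open Classical in
theorem cellVal_eq (n s t : ℕ) (i j : Fin n) :
    cellVal n s t ((i : ℕ) * n + j) =
      if FreeCell (bitSet n s) (bitSet n t) i j then 1 else 0 := by
  rw [cellVal, (cell_div i j).1, (cell_div i j).2]
  simp only [bitVal_eq]
  by_cases h1 : i ∈ bitSet n t <;> by_cases h2 : j ∈ bitSet n s <;>
    by_cases h3 : j ∈ bitSet n t <;> by_cases h4 : i < j <;> simp [FreeCell, h1, h2, h3, h4]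

open Classical in
theorem rankVal_eq_card (n s t : ℕ) : rankVal n s t (n * n) =
    (Finset.univ.filter fun p : Fin n × Fin n =>
      FreeCell (bitSet n s) (bitSet n t) p.1 p.2).card := by
  rw [rankVal, sum_range_mul_self, Finset.card_filter]
  exact Finset.sum_congr rfl fun p _ => cellVal_eq n s t p.1 p.2

theorem pairsVal_eq (n s : ℕ) : pairsVal n s = numPairs (bitSet n s) := by
  classical
  rw [pairsVal, sum_range_mul_self, numPairs, Finset.card_filter]
  refine Finset.sum_congr rfl fun p _ => ?_
  rw [(cell_div p.1 p.2).1, (cell_div p.1 p.2).2]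
  simp only [bitVal_eq]
  by_cases h1 : p.1 ∈ bitSet n s <;> by_cases h2 : p.2 ∈ bitSet n s <;>
    by_cases h4 : p.1 < p.2 <;> simp [h1, h2, h4]

theorem colsVal_eq (n s : ℕ) : colsVal n s = (bitSet n s)ᶜ.card := by
  have h : (bitSet n s)ᶜ = Finset.univ.filter fun i => i ∉ bitSet n s := by
    ext i
    simp
  rw [h, colsVal, Finset.sum_range, Finset.card_filter]
  refine Finset.sum_congr rfl fun i _ => ?_
  rw [bitVal_eq]
  split_ifs <;> simp_all

theorem diffVal_eq_zero_iff (n s t : ℕ) : diffVal n s t = 0 ↔ bitSet n t ⊆ bitSet n s := by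
  rw [diffVal, Finset.sum_range, Finset.sum_eq_zero_iff]
  refine forall_congr' fun i => ?_
  simp only [Finset.mem_univ, true_imp_iff, bitVal_eq]
  by_cases h1 : i ∈ bitSet n s <;> by_cases h2 : i ∈ bitSet n t <;> simp [h1, h2]

theorem rankVal_lt (n s t : ℕ) {x y : ℕ} (h : x < y) (hx : cellVal n s t x = 1) :
    rankVal n s t x < rankVal n s t y := by
  have h1 : rankVal n s t (x + 1) ≤ rankVal n s t y :=
    Finset.sum_le_sum_of_subset (Finset.range_mono h)
  rw [rankVal, Finset.sum_range_succ, hx] at h1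
  exact h1

/-- The free cells are numbered by the number of free cells before them. -/
theorem exists_cellEquiv (n s t : ℕ) :
    ∃ e : {p : Fin n × Fin n // FreeCell (bitSet n s) (bitSet n t) p.1 p.2} ≃
      Fin (rankVal n s t (n * n)),
      ∀ p, (e p : ℕ) = rankVal n s t ((p.1.1 : ℕ) * n + p.1.2) := by
  classical
  have hc : ∀ p : {p : Fin n × Fin n // FreeCell (bitSet n s) (bitSet n t) p.1 p.2},
      cellVal n s t ((p.1.1 : ℕ) * n + p.1.2) = 1 := fun p => by rw [cellVal_eq, if_pos p.2]
  let g : {p : Fin n × Fin n // FreeCell (bitSet n s) (bitSet n t) p.1 p.2} →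
      Fin (rankVal n s t (n * n)) := fun p => ⟨rankVal n s t ((p.1.1 : ℕ) * n + p.1.2),
        rankVal_lt n s t (cell_lt p.1.1.2 p.1.2.2) (hc p)⟩
  have hg : Function.Bijective g := by
    rw [Fintype.bijective_iff_injective_and_card]
    constructor
    · intro p p' h
      have h : rankVal n s t ((p.1.1 : ℕ) * n + p.1.2) =
        rankVal n s t ((p'.1.1 : ℕ) * n + p'.1.2) := congrArg Fin.val h
      have heq : (p.1.1 : ℕ) * n + p.1.2 = (p'.1.1 : ℕ) * n + p'.1.2 := by
        rcases lt_trichotomy ((p.1.1 : ℕ) * n + p.1.2) ((p'.1.1 : ℕ) * n + p'.1.2) with h' | h' | h'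
        · exact absurd h (rankVal_lt n s t h' (hc p)).ne
        · exact h'
        · exact absurd h (rankVal_lt n s t h' (hc p')).ne'
      have h1 := cell_div p.1.1 p.1.2
      have h2 := cell_div p'.1.1 p'.1.2
      rw [heq] at h1
      exact Subtype.ext (Prod.ext (Fin.ext (h1.1.symm.trans h2.1)) (Fin.ext (h1.2.symm.trans h2.2)))
    · rw [Fintype.card_fin, rankVal_eq_card, Fintype.card_subtype]
  exact ⟨Equiv.ofBijective g hg, fun p => rfl⟩

variable {F : Type*} [Field F] [Fintype F]

/-- The echelon matrix with the given codes. -/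
def echMatrix (I : Setting F) (s t z : ℕ) : Matrix (Fin I.n) (Fin I.n) F :=
  Matrix.of fun i j => echVal I s t z i j

theorem echMatrix_eq (I : Setting F) (s t : ℕ)
    (e : {p : Fin I.n × Fin I.n // FreeCell (bitSet I.n s) (bitSet I.n t) p.1 p.2} ≃
      Fin (rankVal I.n s t (I.n * I.n)))
    (he : ∀ p, (e p : ℕ) = rankVal I.n s t ((p.1.1 : ℕ) * I.n + p.1.2))
    (f : Fin (rankVal I.n s t (I.n * I.n)) → Fin (Fintype.card F)) :
    echMatrix I s t (finFunctionFinEquiv f : Fin _) = coordProj F (bitSet I.n t) +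
      matrixOfCells (FreeCell (bitSet I.n s) (bitSet I.n t)) fun p => I.enc.symm (f (e p)) := by
  classical
  ext i j
  rw [Matrix.add_apply, coordProj_apply, echMatrix, Matrix.of_apply, echVal, matrixOfCells]
  by_cases hij : i = j
  · subst hij
    have h : ¬FreeCell (bitSet I.n s) (bitSet I.n t) i i := fun h => lt_irrefl _ h.2.2.2
    rw [if_pos rfl, dif_neg h, bitVal_eq]
    by_cases hi : i ∈ bitSet I.n t <;> simp [hi]
  · rw [if_neg (show ¬(i : ℕ) = j from fun h => hij (Fin.ext h)),
      if_neg (show ¬(i = j ∧ i ∈ bitSet I.n t) from fun h => hij h.1), zero_add, cellVal_eq]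
    by_cases h : FreeCell (bitSet I.n s) (bitSet I.n t) i j
    · have hd := finFunctionFinEquiv_div_mod f (e ⟨(i, j), h⟩)
      rw [he] at hd
      rw [if_pos h, if_neg one_ne_zero, dif_pos h, hd, decode, dif_pos (Fin.is_lt _)]
    · rw [if_neg h, if_pos rfl, dif_neg h]

theorem sum_echMatrix {R : Type*} [AddCommMonoid R] (I : Setting F) (s t : ℕ)
    (h : Matrix (Fin I.n) (Fin I.n) F → R) :
    ∑ z ∈ Finset.range (Fintype.card F ^ rankVal I.n s t (I.n * I.n)), h (echMatrix I s t z) =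
      ∑ M ∈ supportedMatrices F (FreeCell (bitSet I.n s) (bitSet I.n t)),
        h (coordProj F (bitSet I.n t) + M) := by
  classical
  obtain ⟨e, he⟩ := exists_cellEquiv I.n s t
  rw [sum_range_pow_eq _ _ fun z => h (echMatrix I s t z)]
  simp only [echMatrix_eq I s t e he]
  rw [← sum_matrixOfCells (FreeCell (bitSet I.n s) (bitSet I.n t))
    fun M => h (coordProj F (bitSet I.n t) + M)]
  exact Equiv.sum_comp ((e.arrowCongr I.enc).symm)
    fun x => h (coordProj F (bitSet I.n t) +
      matrixOfCells (FreeCell (bitSet I.n s) (bitSet I.n t)) x)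

theorem exists_echMatrix_eq (I : Setting F) (s t z : ℕ)
    (hz : z < Fintype.card F ^ rankVal I.n s t (I.n * I.n)) :
    ∃ M ∈ supportedMatrices F (FreeCell (bitSet I.n s) (bitSet I.n t)),
      echMatrix I s t z = coordProj F (bitSet I.n t) + M := by
  classical
  obtain ⟨e, he⟩ := exists_cellEquiv I.n s t
  refine ⟨matrixOfCells _ fun p => I.enc.symm (finFunctionFinEquiv.symm ⟨z, hz⟩ (e p)), ?_, ?_⟩
  rotate_left
  · rw [← echMatrix_eq I s t e he (finFunctionFinEquiv.symm ⟨z, hz⟩), Equiv.apply_symm_apply]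
  · rw [mem_supportedMatrices]
    intro i j h
    simp [matrixOfCells, h]

theorem prodVal_eq (I : Setting F) (s z t y : ℕ) (i a : Fin I.n) :
    prodVal I s z t y i a = (echMatrix I s t y * echMatrix I (2 ^ I.n - 1) s z) i a := by
  rw [prodVal, Finset.sum_range, Matrix.mul_apply]
  rfl

theorem formVal_eq (I : Setting F) (A : ℕ → ℕ → ℕ → F) (s z t y l : ℕ) (i j : Fin I.n) :
    formVal I A s z t y l i j =
      ((echMatrix I s t y * echMatrix I (2 ^ I.n - 1) s z) *
        (Matrix.of fun a b : Fin I.n => A l a b) *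
        (echMatrix I s t y * echMatrix I (2 ^ I.n - 1) s z)ᵀ) i j := by
  rw [mul_mul_transpose_apply]
  simp only [formVal, Finset.sum_range, prodVal_eq, dotProduct, Matrix.mulVec, Finset.mul_sum,
    Matrix.of_apply]

theorem violVal_eq_zero_iff (I : Setting F) (A : ℕ → ℕ → ℕ → F) (m s z t y : ℕ)
    {𝒜 : Submodule F (Matrix (Fin I.n) (Fin I.n) F)}
    (h𝒜 : Submodule.span F (Set.range fun l : Fin m =>
      (Matrix.of fun a b : Fin I.n => A l a b : Matrix (Fin I.n) (Fin I.n) F)) = 𝒜) :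
    violVal I A m s z t y = 0 ↔
      IsotropicRows 𝒜 (echMatrix I s t y * echMatrix I (2 ^ I.n - 1) s z) := by
  classical
  set G := echMatrix I s t y * echMatrix I (2 ^ I.n - 1) s z with hG
  have h1 : violVal I A m s z t y = 0 ↔
      ∀ l : Fin m, G * (Matrix.of fun a b : Fin I.n => A l a b) * Gᵀ = 0 := by
    simp only [violVal, Finset.sum_range, Finset.sum_eq_zero_iff, Finset.mem_univ, true_imp_iff,
      formVal_eq, ← Matrix.ext_iff, Matrix.zero_apply]
    simp [hG]
  rw [h1]
  constructor
  · intro h B hB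
    rw [← h𝒜] at hB
    induction hB using Submodule.span_induction with
    | mem B hB =>
      obtain ⟨l, rfl⟩ := hB
      exact h l
    | zero => simp
    | add B B' _ _ h1 h2 => rw [Matrix.mul_add, Matrix.add_mul, h1, h2, add_zero]
    | smul c B _ h1 => rw [Matrix.mul_smul, Matrix.smul_mul, h1, smul_zero]
  · intro h l
    refine h _ ?_
    rw [← h𝒜]
    exact Submodule.subset_span ⟨l, rfl⟩

theorem countVal_eq (I : Setting F) (A : ℕ → ℕ → ℕ → F) (m s z : ℕ)
    {𝒜 : Submodule F (Matrix (Fin I.n) (Fin I.n) F)}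
    (h𝒜 : Submodule.span F (Set.range fun l : Fin m =>
      (Matrix.of fun a b : Fin I.n => A l a b : Matrix (Fin I.n) (Fin I.n) F)) = 𝒜)
    (hz : z < Fintype.card F ^ rankVal I.n (2 ^ I.n - 1) s (I.n * I.n)) :
    countVal I A m s z = numIsotropic 𝒜 (echMatrix I (2 ^ I.n - 1) s z) := by
  classical
  set E := echMatrix I (2 ^ I.n - 1) s z with hE
  have hpiv : pivots E = bitSet I.n s := by
    obtain ⟨M, hM, h⟩ := exists_echMatrix_eq I _ s z hz
    rw [bitSet_full] at hM
    rw [hE, h, (isEchelon_coordProj_add (Finset.subset_univ _) hM).2]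
  rw [numIsotropic, hpiv, Finset.card_filter, ← sum_echelonMatrices (bitSet I.n s)
    fun K => if IsotropicRows 𝒜 (K * E) then 1 else 0]
  simp only [countVal, violVal_eq_zero_iff I A m s z _ _ h𝒜, diffVal_eq_zero_iff]
  have hpow : (bitSet I.n s).powerset = Finset.univ.filter (· ⊆ bitSet I.n s) := by
    ext T
    simp
  rw [hpow, Finset.sum_filter, ← sum_bitSet]
  refine Finset.sum_congr rfl fun t _ => ?_
  split_ifs
  · exact sum_echMatrix I s t fun K => if IsotropicRows 𝒜 (K * E) then 1 else 0
  · rfl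

theorem termsVal_sub (I : Setting F) (A : ℕ → ℕ → ℕ → F) (m c : ℕ)
    {𝒜 : Submodule F (Matrix (Fin I.n) (Fin I.n) F)}
    (h𝒜 : Submodule.span F (Set.range fun l : Fin m =>
      (Matrix.of fun a b : Fin I.n => A l a b : Matrix (Fin I.n) (Fin I.n) F)) = 𝒜) :
    (termsVal I A m 0 c : ℤ) - termsVal I A m 1 c =
      ∑ E ∈ echelonMatrices F (Finset.univ : Finset (Fin I.n)),
        moebiusWeight F (pivots E) * (numIsotropic 𝒜 E : ℤ) ^ c := by
  classical
  rw [← sum_echelonMatrices, Finset.powerset_univ, ← sum_bitSet]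
  simp only [termsVal, Nat.cast_sum]
  rw [← Finset.sum_sub_distrib]
  refine Finset.sum_congr rfl fun s _ => ?_
  have h1 : ∑ M ∈ supportedMatrices F (FreeCell Finset.univ (bitSet I.n s)),
      moebiusWeight F (pivots (coordProj F (bitSet I.n s) + M)) *
        (numIsotropic 𝒜 (coordProj F (bitSet I.n s) + M) : ℤ) ^ c =
      moebiusWeight F (bitSet I.n s) * ((∑ z ∈ Finset.range
        (Fintype.card F ^ rankVal I.n (2 ^ I.n - 1) s (I.n * I.n)), countVal I A m s z ^ c : ℕ) : ℤ) := by
    have hcount : ∀ z ∈ Finset.range (Fintype.card F ^ rankVal I.n (2 ^ I.n - 1) s (I.n * I.n)),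
        countVal I A m s z ^ c = numIsotropic 𝒜 (echMatrix I (2 ^ I.n - 1) s z) ^ c :=
      fun z hz => by rw [countVal_eq I A m s z h𝒜 (Finset.mem_range.1 hz)]
    rw [Finset.sum_congr rfl hcount,
      sum_echMatrix I (2 ^ I.n - 1) s fun E => numIsotropic 𝒜 E ^ c, bitSet_full, Nat.cast_sum,
      Finset.mul_sum]
    refine Finset.sum_congr rfl fun M hM => ?_
    rw [(isEchelon_coordProj_add (Finset.subset_univ _) hM).2, Nat.cast_pow]
  rw [h1, moebiusWeight, ← colsVal_eq, ← pairsVal_eq]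
  rcases Nat.mod_two_eq_zero_or_one (colsVal I.n s) with h | h
  · rw [if_pos h, if_neg (by omega), (Nat.even_iff.2 h).neg_one_pow]
    push_cast
    ring
  · rw [if_neg (by omega), if_pos h, (Nat.odd_iff.2 h).neg_one_pow]
    push_cast
    ring

theorem answerVal_eq (I : Setting F) (A : ℕ → ℕ → ℕ → F) (m : ℕ)
    {𝒜 : Submodule F (Matrix (Fin I.n) (Fin I.n) F)} (halt : 𝒜 ≤ alternatingMatrices I.n F)
    (h𝒜 : Submodule.span F (Set.range fun l : Fin m =>
      (Matrix.of fun a b : Fin I.n => A l a b : Matrix (Fin I.n) (Fin I.n) F)) = 𝒜) :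
    answerVal I A m = isotropicDecompositionNumber 𝒜 := by
  classical
  rw [isotropicDecompositionNumber_eq_sum halt, answerVal]
  refine Finset.sum_congr rfl fun c _ => ?_
  have h1 := sum_moebiusWeight_pos_iff 𝒜 c
  rw [← termsVal_sub I A m c h𝒜] at h1
  by_cases h : SpannedByIsotropic 𝒜 c
  · rw [if_pos h, if_neg]
    have := h1.2 h
    omega
  · rw [if_neg h, if_pos]
    have := mt h1.1 h
    omega

open Classical in
/-- The number of free cells is at most the product of the numbers of pivots and of other
columns. -/
theorem rankVal_le_mul (n s t : ℕ) (h : bitSet n t ⊆ bitSet n s) :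
    rankVal n s t (n * n) ≤
      (bitSet n t).card * ((bitSet n s).card - (bitSet n t).card) := by
  rw [rankVal_eq_card, ← Finset.card_sdiff_of_subset h, ← Finset.card_product]
  refine Finset.card_le_card fun p hp => ?_
  have hp := (Finset.mem_filter.1 hp).2
  rw [Finset.mem_product, Finset.mem_sdiff]
  exact ⟨hp.1, hp.2.1, hp.2.2.1⟩

theorem mul_sub_le (d k : ℕ) : k * (d - k) ≤ d ^ 2 / 4 := by
  rcases le_total k d with h | h
  · obtain ⟨e, rfl⟩ := Nat.exists_eq_add_of_le h
    rw [Nat.le_div_iff_mul_le (by norm_num), Nat.add_sub_cancel_left]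
    zify
    nlinarith [sq_nonneg ((k : ℤ) - e)]
  · simp [Nat.sub_eq_zero_of_le h]

/-- The dimension count of flags: `d (n - d) + d² / 4` is largest for `d = 2 n / 3`. -/
theorem mul_sub_add_le {n d : ℕ} (h : d ≤ n) : d * (n - d) + d ^ 2 / 4 ≤ n ^ 2 / 3 := by
  obtain ⟨e, rfl⟩ := Nat.exists_eq_add_of_le h
  rw [Nat.le_div_iff_mul_le (by norm_num), Nat.add_sub_cancel_left]
  have h1 : 4 * (d ^ 2 / 4) ≤ d ^ 2 := Nat.mul_div_le _ _
  zify at h1 ⊢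
  nlinarith [sq_nonneg ((d : ℤ) - 2 * e)]

end Decoding

end FieldRAM

/-! ### Running time -/

namespace FieldRAM

theorem card_basis_le {F : Type*} [Field F] {n m : ℕ} {𝒜 : Submodule F (Matrix (Fin n) (Fin n) F)}
    (b : Module.Basis (Fin m) F 𝒜) : m ≤ n * n := by
  have h1 := Module.finrank_eq_card_basis b
  have h2 := Submodule.finrank_le 𝒜
  rw [Module.finrank_matrix] at h2
  simp_all

theorem inputState_arr {F : Type*} [Fintype F] (enc : F ≃ Fin (Fintype.card F)) {n m : ℕ}
    (A : Fin m → Matrix (Fin n) (Fin n) F) (l : Fin m) (i j : Fin n) :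
    (inputState enc A).arr 0 (((l : ℕ) * n + i) * n + j) = enc (A l i j) := by
  have hlt : ((l : ℕ) * n + i) * n + j < m * (n * n) := by
    have h1 : (l : ℕ) * n + i + 1 ≤ m * n := by
      have := Nat.mul_le_mul_right n (show (l : ℕ) + 1 ≤ m from l.2)
      have := i.2
      nlinarith
    have h2 := Nat.mul_le_mul_right n h1
    have := j.2
    nlinarith
  have hcell : (i : ℕ) * n + j < n * n := cell_lt i.2 j.2
  have hx : ((l : ℕ) * n + i) * n + j = (n * n) * l + (i * n + j) := by ring
  have hd : (((l : ℕ) * n + i) * n + j) / (n * n) = l := by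
    rw [hx, Nat.mul_add_div (by omega), Nat.div_eq_of_lt hcell, add_zero]
  have hm : (((l : ℕ) * n + i) * n + j) % (n * n) = i * n + j := by
    rw [hx, Nat.mul_add_mod, Nat.mod_eq_of_lt hcell]
  have e1 : (⟨_, hlt⟩ : Fin (m * (n * n))).divNat = l := Fin.ext hd
  have e2 : (⟨_, hlt⟩ : Fin (m * (n * n))).modNat.divNat = i :=
    Fin.ext ((congrArg (· / n) hm).trans (cell_div i j).1)
  have e3 : (⟨_, hlt⟩ : Fin (m * (n * n))).modNat.modNat = j :=
    Fin.ext ((congrArg (· % n) hm).trans (cell_div i j).2)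
  simp only [inputState, if_true, dif_pos hlt, e1, e2, e3]

variable {F : Type*} [Field F] [Fintype F]

/-- The run of the program: it takes `q ^ (n² / 3)` rounds, each of cost `q ^ O(n)`. -/
theorem exists_run (enc : F ≃ Fin (Fintype.card F)) {n m : ℕ}
    (𝒜 : Submodule F (Matrix (Fin n) (Fin n) F)) (h𝒜 : 𝒜 ≤ alternatingMatrices n F)
    (b : Module.Basis (Fin m) F 𝒜) :
    ∃ (s : State) (t : ℕ),
      Exec enc (.seq (answerC 3) (.assign 0 (.reg 3)))
        (inputState enc fun k => (b k : Matrix (Fin n) (Fin n) F)) s t ∧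
      s.reg 0 = isotropicDecompositionNumber 𝒜 ∧
      t ≤ Fintype.card F ^ (n ^ 2 / 3) * Fintype.card F ^ ((n + 1) * (1050 + 2)) := by
  classical
  set s₀ := inputState enc fun k => (b k : Matrix (Fin n) (Fin n) F) with hs₀
  let I : Setting F := ⟨enc, n, s₀.arr 0⟩
  let Γ : Ctx := ⟨3, s₀.reg⟩
  let A : ℕ → ℕ → ℕ → F := fun l i j => if h : l < m ∧ i < n ∧ j < n then
    (b ⟨l, h.1⟩ : Matrix (Fin n) (Fin n) F) ⟨i, h.2.1⟩ ⟨j, h.2.2⟩ else 0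
  have hA : Holds I m A := by
    intro l hl i hi j hj
    have := inputState_arr enc (fun k => (b k : Matrix (Fin n) (Fin n) F)) ⟨l, hl⟩ ⟨i, hi⟩ ⟨j, hj⟩
    have hv : A l i j = (b ⟨l, hl⟩ : Matrix (Fin n) (Fin n) F) ⟨i, hi⟩ ⟨j, hj⟩ :=
      dif_pos ⟨hl, hi, hj⟩
    rw [hv]
    exact this
  have hm : m ≤ I.Q ^ 2 := (card_basis_le b).trans I.n_mul_n_le_Q
  have hΓ : Base I m Γ := by
    refine ⟨comp_var 0 1 (by simp [Γ]) ?_, comp_var 1 1 (by simp [Γ]) ?_,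
      (comp_var 2 2 (by simp [Γ]) ?_).mono le_rfl (by norm_num)⟩
    · exact (size_le_self _).trans (I.n_le_Q_pow le_rfl)
    · rw [pow_one]
      exact (size_le_self _).trans I.card_le_Q
    · exact (size_le_self _).trans hm
  have hspan : Submodule.span F (Set.range fun l : Fin m =>
      (Matrix.of fun i j : Fin n => A l i j : Matrix (Fin n) (Fin n) F)) = 𝒜 := by
    have hAb : (fun l : Fin m => (Matrix.of fun i j : Fin n => A l i j :
        Matrix (Fin n) (Fin n) F)) = 𝒜.subtype ∘ b := by
      funext l
      ext i j
      exact dif_pos ⟨l.2, i.2, j.2⟩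
    rw [hAb, Set.range_comp, ← Submodule.map_span, b.span_eq, Submodule.map_top,
      Submodule.range_subtype]
  have hq : 1 ≤ Fintype.card F := Fintype.card_pos
  have hcomp := comp_answer (W := Fintype.card F ^ (n ^ 2 / 3)) hΓ hm hA
    (Nat.one_le_pow _ _ hq) (fun s => Fintype.card F ^ ((bitSet n s).card ^ 2 / 4))
    (fun s => Nat.one_le_pow _ _ hq)
    (fun s _ t _ h => Nat.pow_le_pow_right hq
      ((rankVal_le_mul n s t ((diffVal_eq_zero_iff n s t).1 h)).trans (mul_sub_le _ _)))
    (fun s _ => by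
      rw [← pow_add]
      refine Nat.pow_le_pow_right hq ?_
      have h1 := rankVal_le_mul n (2 ^ n - 1) s (by rw [bitSet_full]; exact Finset.subset_univ _)
      rw [bitSet_full, Finset.card_univ, Fintype.card_fin] at h1
      have h2 : (bitSet n s).card ≤ n := by
        simpa using Finset.card_le_univ (bitSet n s)
      exact (Nat.add_le_add_right h1 _).trans (mul_sub_add_le h2))
  rw [answerVal_eq I A m h𝒜 hspan] at hcomp
  obtain ⟨s₁, t₁, e₁, l₁, v₁, -, -⟩ := hcomp.2.2 3 s₀ (Ctx.le_refl _) rfl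
  refine ⟨_, _, .seq e₁ (.assign 0 (.reg 3) s₁), ?_, ?_⟩
  · simpa [State.setReg, Expr.eval] using v₁
  · simp only [Expr.cost, v₁]
    have h1 := hcomp.size_le
    have h2 : I.Q ^ 1050 ≤ Fintype.card F ^ (n ^ 2 / 3) * I.Q ^ 1050 :=
      Nat.le_mul_of_pos_left _ (Nat.one_le_pow _ _ hq)
    have h3 := I.Q_pos 1050
    have h4 := Nat.mul_le_mul_left (Fintype.card F ^ (n ^ 2 / 3))
      (I.mul_Q_le (c := 4) (j := 2) (by norm_num) 1050)
    have h5 : I.Q ^ (1050 + 2) = Fintype.card F ^ ((n + 1) * (1050 + 2)) :=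
      I.Q_pow _
    rw [← h5]
    refine le_trans ?_ h4
    have h6 : Fintype.card F ^ (n ^ 2 / 3) * (4 * I.Q ^ 1050) =
      4 * (Fintype.card F ^ (n ^ 2 / 3) * I.Q ^ 1050) := by ring
    omega

end FieldRAM

theorem mainTheorem4 :
    ∃ (P : FieldRAM.Prog) (C : ℝ),
      ∀ (F : Type*) [Field F] [Fintype F] (enc : F ≃ Fin (Fintype.card F)) (n m : ℕ)
        (𝒜 : Submodule F (Matrix (Fin n) (Fin n) F)) (_h𝒜 : 𝒜 ≤ alternatingMatrices n F)
        (b : Module.Basis (Fin m) F 𝒜),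
        ∃ (s : FieldRAM.State) (t : ℕ),
          FieldRAM.Exec enc P
            (FieldRAM.inputState enc fun k => (b k : Matrix (Fin n) (Fin n) F)) s t ∧
          s.reg 0 = isotropicDecompositionNumber 𝒜 ∧
          (0 < n →
            (t : ℝ) ≤ (Fintype.card F : ℝ) ^ ((5 / 12 : ℝ) * (n : ℝ) ^ 2 + C * (n : ℝ))) := by
  -- `2104 = 2 * 1052`, since `n + 1 ≤ 2 * n`
  refine ⟨.seq (FieldRAM.answerC 3) (.assign 0 (.reg 3)), 2104, fun F _ _ enc n m 𝒜 h𝒜 b => ?_⟩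
  obtain ⟨s, t, he, hs, ht⟩ := FieldRAM.exists_run enc 𝒜 h𝒜 b
  refine ⟨s, t, he, hs, fun hn => ?_⟩
  have hq : (1 : ℝ) ≤ Fintype.card F := by exact_mod_cast (Fintype.card_pos : 0 < Fintype.card F)
  rw [← pow_add] at ht
  have h1 : (t : ℝ) ≤ (Fintype.card F : ℝ) ^ (n ^ 2 / 3 + (n + 1) * (1050 + 2)) := by exact_mod_cast ht
  refine h1.trans ?_
  rw [← Real.rpow_natCast]
  refine Real.rpow_le_rpow_of_exponent_le hq ?_
  have h2 : ((n ^ 2 / 3 : ℕ) : ℝ) ≤ (n : ℝ) ^ 2 / 3 := by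
    exact_mod_cast Nat.cast_div_le (α := ℝ) (m := n ^ 2) (n := 3)
  have h3 : (1 : ℝ) ≤ n := by exact_mod_cast hn
  push_cast at h2 ⊢
  nlinarith [sq_nonneg (n : ℝ)]
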